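/- Let $M$ be a smooth manifold of dimension $2n+1$ with a paracontact metric structure $(\varphi,\xi,\eta,g)$. That is, $\eta$ is a smooth 1-form with $\eta\wedge(d\eta)^n\neq 0$ everywhere; $\xi$ is its Reeb vector field, so $\eta(\xi)=1$ and $d\eta(\xi,\cdot)=0$; $g$ is a semi-Riemannian metric and $\varphi$ a smooth $(1,1)$-tensor field with $$\eta=g(\xi,\cdot),\qquad d\eta(X,Y)=g(X,\varphi Y),\qquad \varphi^2=I-\eta\otimes\xi ,$$ where $d\eta(X,Y)=\tfrac12\big(X\eta(Y)-Y\eta(X)-\eta([X,Y])\big)$. Let $\nabla$ be the Levi-Civita connection of $g$, $R_{XY}=\nabla_{[X,Y]}-[\nabla_X,\nabla_Y]$ its curvature, $\varrho(X,Y)=\operatorname{tr}(Z\mapsto R_{XZ}Y)$ the Ricci tensor, $Q$ the Ricci operator, defined by $g(QX,Y)=\varrho(X,Y)$, and $h=\tfrac12\mathcal L_\xi\varphi$. For a vector field $V$ and any local pseudo-orthonormal frame $\{E_i\}$ with $\varepsilon_i=g(E_i,E_i)=\pm1$, put $$\bar\Delta V=\sum_i\varepsilon_i\big(\nabla_{\nabla_{E_i}E_i}V-\nabla_{E_i}\nabla_{E_i}V\big),\qquad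 \|\nabla V\|^2=\sum_i\varepsilon_i\,g(\nabla_{E_i}V,\nabla_{E_i}V).$$ Then $$\bar\Delta\xi=-4n\,\xi-Q\xi=\|\nabla\xi\|^2\,\xi-\operatorname{pr}_{\ker\eta}(Q\xi),\qquad \|\nabla\xi\|^2=-(2n+\operatorname{tr}h^2),$$ where $\operatorname{pr}_{\ker\eta}(X)=X-\eta(X)\xi$ is the projection onto $\ker\eta$. -/

import Mathlib

open scoped Manifold ContDiff Bundle

set_option linter.unusedSectionVars false

noncomputable section

namespace Paracontact

open VectorField FiberBundle Bundle

variable {E : Type*} [NormedAddCommGroup E] [NormedSpace ℝ E] [FiniteDimensional ℝ E]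
  {M : Type*} [TopologicalSpace M] [ChartedSpace E M] [IsManifold 𝓘(ℝ, E) ∞ M]

/-- A semi-Riemannian metric: a smooth field of nondegenerate symmetric bilinear forms on the
tangent spaces, of arbitrary signature. -/
structure SemiRiemannianMetric (E : Type*) [NormedAddCommGroup E] [NormedSpace ℝ E]
    (M : Type*) [TopologicalSpace M] [ChartedSpace E M] [IsManifold 𝓘(ℝ, E) ∞ M] where
  /-- the bilinear form on each tangent space -/
  val : ∀ x : M, TangentSpace 𝓘(ℝ, E) x →L[ℝ] TangentSpace 𝓘(ℝ, E) x →L[ℝ] ℝ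
  symm : ∀ (x : M) (v w : TangentSpace 𝓘(ℝ, E) x), val x v w = val x w v
  nondegenerate : ∀ (x : M) (v : TangentSpace 𝓘(ℝ, E) x), (∀ w, val x v w = 0) → v = 0
  contMDiff : ContMDiff 𝓘(ℝ, E) (𝓘(ℝ, E).prod 𝓘(ℝ, E →L[ℝ] E →L[ℝ] ℝ)) ∞
    (fun x ↦ TotalSpace.mk' (E →L[ℝ] E →L[ℝ] ℝ)
      (E := fun x : M ↦ TangentSpace 𝓘(ℝ, E) x →L[ℝ] TangentSpace 𝓘(ℝ, E) x →L[ℝ] ℝ) x (val x))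

namespace SemiRiemannianMetric

variable (g : SemiRiemannianMetric E M)

theorem mdiffAt_apply {X Y : ∀ x : M, TangentSpace 𝓘(ℝ, E) x} {x : M}
    (hX : MDiffAt (T% X) x) (hY : MDiffAt (T% Y) x) :
    MDiffAt (fun y ↦ g.val y (X y) (Y y)) x := by
  have hg := (g.contMDiff x).mdifferentiableAt (by simp)
  have : MDifferentiableAt 𝓘(ℝ, E) (𝓘(ℝ, E).prod 𝓘(ℝ)) (fun m ↦
      TotalSpace.mk' ℝ (E := Bundle.Trivial M ℝ) m (g.val m (X m) (Y m))) x :=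
    MDifferentiableAt.clm_bundle_apply₂ (F₁ := E) (F₂ := E) hg hX hY
  simpa [mdifferentiableAt_section] using this

/-- The right hand side of the Koszul formula for `2 g(∇_X Y, Z)` at `x`. -/
def koszul (X Y Z : ∀ x : M, TangentSpace 𝓘(ℝ, E) x) (x : M) : ℝ :=
  d% (fun y ↦ g.val y (Y y) (Z y)) x (X x)
    + d% (fun y ↦ g.val y (X y) (Z y)) x (Y x)
    - d% (fun y ↦ g.val y (X y) (Y y)) x (Z x)
    + g.val x (mlieBracket 𝓘(ℝ, E) X Y x) (Z x)
    - g.val x (mlieBracket 𝓘(ℝ, E) X Z x) (Y x)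
    - g.val x (mlieBracket 𝓘(ℝ, E) Y Z x) (X x)

theorem d_smul_left {f : M → ℝ} {X Y : ∀ x : M, TangentSpace 𝓘(ℝ, E) x} {x : M}
    (hf : MDiffAt f x) (hX : MDiffAt (T% X) x) (hY : MDiffAt (T% Y) x)
    (v : TangentSpace 𝓘(ℝ, E) x) :
    d% (fun y ↦ g.val y ((f • X) y) (Y y)) x v =
      f x * d% (fun y ↦ g.val y (X y) (Y y)) x v + d% f x v * g.val x (X x) (Y x) := by
  have h := g.mdiffAt_apply hX hY
  have : (fun y ↦ g.val y ((f • X) y) (Y y)) = fun y ↦ f y * g.val y (X y) (Y y) := by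
    ext y; simp
  rw [this, mvfderiv_fun_mul hf h]
  simp; ring

theorem d_smul_right {f : M → ℝ} {X Y : ∀ x : M, TangentSpace 𝓘(ℝ, E) x} {x : M}
    (hf : MDiffAt f x) (hX : MDiffAt (T% X) x) (hY : MDiffAt (T% Y) x)
    (v : TangentSpace 𝓘(ℝ, E) x) :
    d% (fun y ↦ g.val y (X y) ((f • Y) y)) x v =
      f x * d% (fun y ↦ g.val y (X y) (Y y)) x v + d% f x v * g.val x (X x) (Y x) := by
  have h := g.mdiffAt_apply hX hY
  have : (fun y ↦ g.val y (X y) ((f • Y) y)) = fun y ↦ f y * g.val y (X y) (Y y) := by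
    ext y; simp
  rw [this, mvfderiv_fun_mul hf h]
  simp; ring

theorem d_add_left {X X' Y : ∀ x : M, TangentSpace 𝓘(ℝ, E) x} {x : M}
    (hX : MDiffAt (T% X) x) (hX' : MDiffAt (T% X') x) (hY : MDiffAt (T% Y) x)
    (v : TangentSpace 𝓘(ℝ, E) x) :
    d% (fun y ↦ g.val y ((X + X') y) (Y y)) x v =
      d% (fun y ↦ g.val y (X y) (Y y)) x v + d% (fun y ↦ g.val y (X' y) (Y y)) x v := by
  have : (fun y ↦ g.val y ((X + X') y) (Y y)) =
      fun y ↦ g.val y (X y) (Y y) + g.val y (X' y) (Y y) := by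
    ext y; simp
  rw [this, mvfderiv_fun_add (g.mdiffAt_apply hX hY) (g.mdiffAt_apply hX' hY)]
  simp

theorem d_add_right {X Y Y' : ∀ x : M, TangentSpace 𝓘(ℝ, E) x} {x : M}
    (hX : MDiffAt (T% X) x) (hY : MDiffAt (T% Y) x) (hY' : MDiffAt (T% Y') x)
    (v : TangentSpace 𝓘(ℝ, E) x) :
    d% (fun y ↦ g.val y (X y) ((Y + Y') y)) x v =
      d% (fun y ↦ g.val y (X y) (Y y)) x v + d% (fun y ↦ g.val y (X y) (Y' y)) x v := by
  have : (fun y ↦ g.val y (X y) ((Y + Y') y)) =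
      fun y ↦ g.val y (X y) (Y y) + g.val y (X y) (Y' y) := by
    ext y; simp
  rw [this, mvfderiv_fun_add (g.mdiffAt_apply hX hY) (g.mdiffAt_apply hX hY')]
  simp

theorem koszul_tensorial_left {Y Z : ∀ x : M, TangentSpace 𝓘(ℝ, E) x} {x : M}
    (hY : MDiffAt (T% Y) x) (hZ : MDiffAt (T% Z) x) :
    TensorialAt 𝓘(ℝ, E) E (fun X ↦ g.koszul X Y Z x) x where
  smul {f X} hf hX := by
    simp only [koszul]
    rw [g.d_smul_left hf hX hZ, g.d_smul_left hf hX hY, mlieBracket_smul_left hf hX,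
      mlieBracket_smul_left hf hX]
    simp [g.symm x (X x)]
    ring
  add {X X'} hX hX' := by
    simp only [koszul]
    rw [g.d_add_left hX hX' hZ, g.d_add_left hX hX' hY, mlieBracket_add_left hX hX',
      mlieBracket_add_left hX hX']
    simp
    ring

theorem koszul_tensorial_right {X Y : ∀ x : M, TangentSpace 𝓘(ℝ, E) x} {x : M}
    (hX : MDiffAt (T% X) x) (hY : MDiffAt (T% Y) x) :
    TensorialAt 𝓘(ℝ, E) E (fun Z ↦ g.koszul X Y Z x) x where
  smul {f Z} hf hZ := by
    simp only [koszul]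
    rw [g.d_smul_right hf hY hZ, g.d_smul_right hf hX hZ, mlieBracket_smul_right hf hZ,
      mlieBracket_smul_right hf hZ]
    simp [g.symm x (Z x)]
    ring
  add {Z Z'} hZ hZ' := by
    simp only [koszul]
    rw [g.d_add_right hY hZ hZ', g.d_add_right hX hZ hZ', mlieBracket_add_right hZ hZ',
      mlieBracket_add_right hZ hZ']
    simp
    ring

/-- The metric at a point, as a bilinear form in the sense of linear algebra. -/
def bilin (x : M) : LinearMap.BilinForm ℝ (TangentSpace 𝓘(ℝ, E) x) :=
  LinearMap.mk₂ ℝ (fun v w ↦ g.val x v w) (by simp) (by simp) (by simp) (by simp)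

theorem bilin_isSymm (x : M) : (g.bilin x).IsSymm := ⟨fun v w ↦ g.symm x v w⟩

theorem bilin_nondegenerate (x : M) : (g.bilin x).Nondegenerate := by
  refine (LinearMap.IsRefl.nondegenerate_iff_separatingLeft (B := g.bilin x)
    (g.bilin_isSymm x).isRefl).2 ?_
  exact fun v hv ↦ g.nondegenerate x v hv

instance tangentSpace_finiteDimensional (x : M) :
    FiniteDimensional ℝ (TangentSpace 𝓘(ℝ, E) x) :=
  inferInstanceAs (FiniteDimensional ℝ E)

instance tangentSpace_t2Space (x : M) : T2Space (TangentSpace 𝓘(ℝ, E) x) :=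
  inferInstanceAs (T2Space E)

/-- The operator `v ↦ ∇_v Y` at `x`, determined by the Koszul formula
`2 g(∇_X Y, Z) = koszul X Y Z` (with value `0` where `Y` is not differentiable). -/
def nabla (Y : ∀ x : M, TangentSpace 𝓘(ℝ, E) x) (x : M) :
    TangentSpace 𝓘(ℝ, E) x →L[ℝ] TangentSpace 𝓘(ℝ, E) x :=
  open Classical in
  if hY : MDiffAt (T% Y) x then
    LinearMap.toContinuousLinearMap
      { toFun := fun v ↦ ((g.bilin x).toDual (g.bilin_nondegenerate x)).symm
          ((1 / 2 : ℝ) • (TensorialAt.mkHom₂ (fun X Z ↦ g.koszul X Y Z x) x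
            (fun _ hZ ↦ g.koszul_tensorial_left hY hZ)
            (fun _ hX ↦ g.koszul_tensorial_right hX hY) v).toLinearMap)
        map_add' := by intro v w; simp
        map_smul' := by
          intro c v
          simp only [map_smul, ContinuousLinearMap.toLinearMap_smul, smul_comm _ c,
            RingHom.id_apply] }
  else 0

/-- The Koszul formula. -/
theorem two_mul_nabla {X Y Z : ∀ x : M, TangentSpace 𝓘(ℝ, E) x} {x : M}
    (hX : MDiffAt (T% X) x) (hY : MDiffAt (T% Y) x) (hZ : MDiffAt (T% Z) x) :
    2 * g.val x (g.nabla Y x (X x)) (Z x) = g.koszul X Y Z x := by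
  have h := TensorialAt.mkHom₂_apply (x := x) (Φ := fun X Z ↦ g.koszul X Y Z x)
            (fun _ hZ ↦ g.koszul_tensorial_left hY hZ)
            (fun _ hX ↦ g.koszul_tensorial_right hX hY) hX hZ
  rw [← h]
  simp only [nabla, hY, dite_true]
  change 2 * g.bilin x (((g.bilin x).toDual (g.bilin_nondegenerate x)).symm _) (Z x) = _
  rw [LinearMap.BilinForm.apply_toDual_symm_apply]
  simp

theorem eq_of_val_extend {x : M} {v w : TangentSpace 𝓘(ℝ, E) x}
    (h : ∀ Z : (∀ x : M, TangentSpace 𝓘(ℝ, E) x), MDiffAt (T% Z) x →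
      2 * g.val x v (Z x) = 2 * g.val x w (Z x)) : v = w := by
  rw [← sub_eq_zero]
  refine g.nondegenerate x _ fun u ↦ ?_
  have := h (extend E u) (mdifferentiableAt_extend ..)
  simp at this
  simp [this]

/-- The Levi-Civita connection of `g`. The argument order follows Mathlib's convention:
`g.leviCivita Y x v` is `∇_v Y` at the point `x`. -/
def leviCivita :
    CovariantDerivative 𝓘(ℝ, E) E (fun x : M ↦ TangentSpace 𝓘(ℝ, E) x) where
  toFun := g.nabla
  isCovariantDerivativeOnUniv :=
    { add := by
        intro Y Y' x hY hY' _
        ext v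
        refine g.eq_of_val_extend fun Z hZ ↦ ?_
        have hX := mdifferentiableAt_extend 𝓘(ℝ, E) E v
        have hYY := mdifferentiableAt_add_section hY hY'
        have h1 := g.two_mul_nabla hX hY hZ
        have h2 := g.two_mul_nabla hX hY' hZ
        have h3 := g.two_mul_nabla hX hYY hZ
        simp only [extend_apply_self] at h1 h2 h3
        simp only [add_apply, map_add, mul_add]
        rw [h1, h2]
        refine h3.trans ?_
        simp only [koszul]
        rw [g.d_add_left hY hY' hZ, g.d_add_right hX hY hY', mlieBracket_add_right hY hY',
          mlieBracket_add_left hY hY']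
        simp
        ring
      leibniz := by
        intro Y f x hY hf _
        ext v
        refine g.eq_of_val_extend fun Z hZ ↦ ?_
        have hX := mdifferentiableAt_extend 𝓘(ℝ, E) E v
        have hfY := hf.smul_section hY
        have h1 := g.two_mul_nabla hX hY hZ
        have h3 := g.two_mul_nabla hX hfY hZ
        simp only [extend_apply_self] at h1 h3
        refine h3.trans ?_
        have h4 : 2 * g.val x ((f x • g.nabla Y x + (d% f x).smulRight (Y x)) v) (Z x) =
            f x * (2 * g.val x (g.nabla Y x v) (Z x)) + 2 * d% f x v * g.val x (Y x) (Z x) := by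
          simp; ring
        rw [h4, h1]
        simp only [koszul]
        rw [g.d_smul_left hf hY hZ, g.d_smul_right hf hX hY, mlieBracket_smul_right hf hY,
          mlieBracket_smul_left hf hY]
        simp [g.symm x (Y x) v]
        ring }

/-- The Levi-Civita connection is torsion free. -/
theorem leviCivita_torsion {X Y : ∀ x : M, TangentSpace 𝓘(ℝ, E) x} {x : M}
    (hX : MDiffAt (T% X) x) (hY : MDiffAt (T% Y) x) :
    g.leviCivita Y x (X x) - g.leviCivita X x (Y x) = mlieBracket 𝓘(ℝ, E) X Y x := by
  refine g.eq_of_val_extend fun Z hZ ↦ ?_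
  have h1 : 2 * g.val x (g.leviCivita Y x (X x)) (Z x) = _ := g.two_mul_nabla hX hY hZ
  have h2 : 2 * g.val x (g.leviCivita X x (Y x)) (Z x) = _ := g.two_mul_nabla hY hX hZ
  have h3 : (fun y ↦ g.val y (X y) (Y y)) = fun y ↦ g.val y (Y y) (X y) :=
    funext fun y ↦ g.symm y _ _
  have h4 : mlieBracket 𝓘(ℝ, E) Y X x = - mlieBracket 𝓘(ℝ, E) X Y x := mlieBracket_swap_apply
  rw [map_sub, sub_apply, mul_sub, h1, h2]
  simp only [koszul, h3, h4, map_neg, neg_apply]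
  ring

/-- The Levi-Civita connection is compatible with the metric. -/
theorem leviCivita_metric {X Y Z : ∀ x : M, TangentSpace 𝓘(ℝ, E) x} {x : M}
    (hX : MDiffAt (T% X) x) (hY : MDiffAt (T% Y) x) (hZ : MDiffAt (T% Z) x) :
    d% (fun y ↦ g.val y (Y y) (Z y)) x (X x) =
      g.val x (g.leviCivita Y x (X x)) (Z x) + g.val x (Y x) (g.leviCivita Z x (X x)) := by
  have h1 : 2 * g.val x (g.leviCivita Y x (X x)) (Z x) = _ := g.two_mul_nabla hX hY hZ
  have h2 : 2 * g.val x (g.leviCivita Z x (X x)) (Y x) = _ := g.two_mul_nabla hX hZ hY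
  rw [g.symm x (Y x)]
  have h3 : (fun y ↦ g.val y (Z y) (Y y)) = fun y ↦ g.val y (Y y) (Z y) :=
    funext fun y ↦ g.symm y _ _
  have h4 : mlieBracket 𝓘(ℝ, E) Z Y x = - mlieBracket 𝓘(ℝ, E) Y Z x := mlieBracket_swap_apply
  simp only [koszul, h3, h4, map_neg, neg_apply] at h1 h2
  linarith

/-- The trace `∑ᵢⱼ gⁱʲ B(bᵢ, bⱼ)` of a bilinear map `B` on a tangent space with respect to the
metric, written as `∑ᵢ B(bᵢ, bⁱ)` with a basis `bᵢ` and its `g`-dual basis `bⁱ`. -/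
def trace (x : M) {F : Type*} [AddCommGroup F]
    (B : TangentSpace 𝓘(ℝ, E) x → TangentSpace 𝓘(ℝ, E) x → F) : F :=
  let b := Module.finBasis ℝ (TangentSpace 𝓘(ℝ, E) x)
  ∑ i, B (b i) ((g.bilin x).dualBasis (g.bilin_nondegenerate x) b i)

/-- In a pseudo-orthonormal basis the metric trace is `∑ᵢ εᵢ B(eᵢ, eᵢ)`. -/
theorem trace_eq_sum {x : M} {F : Type*} [AddCommGroup F] [Module ℝ F]
    (B : TangentSpace 𝓘(ℝ, E) x →ₗ[ℝ] TangentSpace 𝓘(ℝ, E) x →ₗ[ℝ] F)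
    {ι : Type*} [Fintype ι] [DecidableEq ι] (e : Module.Basis ι ℝ (TangentSpace 𝓘(ℝ, E) x))
    (ε : ι → ℝ) (hε : ∀ i, ε i * ε i = 1)
    (he : ∀ i j, g.val x (e i) (e j) = if i = j then ε i else 0) :
    g.trace x (fun v w ↦ B v w) = ∑ i, ε i • B (e i) (e i) := by
  have hrepr : ∀ v i, e.repr v i = ε i * g.val x v (e i) := by
    intro v i
    conv_rhs => rw [← e.sum_repr v]
    simp only [map_sum, sum_apply, map_smul, smul_apply,
      he, smul_eq_mul, mul_ite, mul_zero, Finset.sum_ite_eq', Finset.mem_univ, if_true]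
    linear_combination (-(e.repr v i)) * hε i
  set b := Module.finBasis ℝ (TangentSpace 𝓘(ℝ, E) x) with hb
  set c := (g.bilin x).dualBasis (g.bilin_nondegenerate x) b with hc
  have hcrepr : ∀ v i, c.repr v i = g.val x v (b i) := fun v i ↦
    LinearMap.BilinForm.dualBasis_repr_apply _ _ _ _
  have key : ∀ k, ∑ i, (g.val x (b i) (e k)) • c i = e k := by
    intro k
    conv_rhs => rw [← c.sum_repr (e k)]
    exact Finset.sum_congr rfl fun i _ ↦ by rw [hcrepr, g.symm]
  calc g.trace x (fun v w ↦ B v w) = ∑ i, B (b i) (c i) := rfl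
    _ = ∑ i, ∑ k, (ε k * g.val x (b i) (e k)) • B (e k) (c i) := by
        refine Finset.sum_congr rfl fun i _ ↦ ?_
        conv_lhs => rw [← e.sum_repr (b i)]
        simp only [map_sum, LinearMap.sum_apply, map_smul, LinearMap.smul_apply, hrepr]
    _ = ∑ k, ε k • B (e k) (e k) := by
        rw [Finset.sum_comm]
        refine Finset.sum_congr rfl fun k _ ↦ ?_
        have h := congrArg (B (e k)) (key k)
        rw [map_sum] at h
        rw [← h, Finset.smul_sum]
        exact Finset.sum_congr rfl fun i _ ↦ by rw [map_smul, smul_smul]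

/-- The curvature tensor with the sign convention `R_{XY} = ∇_{[X,Y]} - [∇_X, ∇_Y]`,
evaluated on vector fields: `g.curvature X Y Z x` is `(R_{XY} Z)(x)`. -/
def curvature (X Y Z : ∀ x : M, TangentSpace 𝓘(ℝ, E) x) (x : M) : TangentSpace 𝓘(ℝ, E) x :=
  g.leviCivita Z x (mlieBracket 𝓘(ℝ, E) X Y x)
    - (g.leviCivita (fun y ↦ g.leviCivita Z y (Y y)) x (X x)
      - g.leviCivita (fun y ↦ g.leviCivita Z y (X y)) x (Y x))

/-- The curvature tensor `R_{uv} w` on tangent vectors at `x`. As the curvature is tensorial, it is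
computed with any smooth local extensions of the vectors. -/
def curvatureAt (x : M) (u v w : TangentSpace 𝓘(ℝ, E) x) : TangentSpace 𝓘(ℝ, E) x :=
  g.curvature (extend E u) (extend E v) (extend E w) x

/-- The Ricci tensor `ϱ(v, w) = tr (z ↦ R_{vz} w) = ∑ᵢ εᵢ g(R_{v eᵢ} w, eᵢ)`. -/
def ricci (x : M) (v w : TangentSpace 𝓘(ℝ, E) x) : ℝ :=
  g.trace x fun z z' ↦ g.val x (g.curvatureAt x v z w) z'

/-- The Ricci operator `Q`, the endomorphism with `g(Q v, w) = ϱ(v, w)`;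
that is, `Q v = ∑ᵢ εᵢ ϱ(v, eᵢ) eᵢ`. -/
def ricciOperator (x : M) (v : TangentSpace 𝓘(ℝ, E) x) : TangentSpace 𝓘(ℝ, E) x :=
  g.trace x fun z z' ↦ g.ricci x v z • z'

/-- The second covariant derivative `∇²_{u,v} V = ∇_u ∇_v V - ∇_{∇_u v} V` at `x`. As it is
tensorial in `u` and `v`, it is computed with any smooth local extension of `v`. -/
def secondCovariantDerivative (V : ∀ x : M, TangentSpace 𝓘(ℝ, E) x) (x : M)
    (u v : TangentSpace 𝓘(ℝ, E) x) : TangentSpace 𝓘(ℝ, E) x :=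
  g.leviCivita (fun y ↦ g.leviCivita V y (extend E v y)) x u
    - g.leviCivita V x (g.leviCivita (extend E v) x u)

/-- The rough Laplacian `Δ̄ V = - tr ∇² V = ∑ᵢ εᵢ (∇_{∇_{eᵢ} eᵢ} V - ∇_{eᵢ} ∇_{eᵢ} V)`. -/
def roughLaplacian (V : ∀ x : M, TangentSpace 𝓘(ℝ, E) x) (x : M) : TangentSpace 𝓘(ℝ, E) x :=
  - g.trace x (g.secondCovariantDerivative V x)

/-- The squared norm `‖∇V‖² = ∑ᵢ εᵢ g(∇_{eᵢ} V, ∇_{eᵢ} V)` (which may be negative). -/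
def normSqNabla (V : ∀ x : M, TangentSpace 𝓘(ℝ, E) x) (x : M) : ℝ :=
  g.trace x fun u v ↦ g.val x (g.leviCivita V x u) (g.leviCivita V x v)

end SemiRiemannianMetric

/-- The exterior derivative of a 1-form, with the normalization
`dη(X, Y) = ½ (X (η Y) - Y (η X) - η [X, Y])`. As it is tensorial, it is computed with any smooth
local extensions of the vectors. -/
def extDerivOneForm (η : ∀ x : M, TangentSpace 𝓘(ℝ, E) x →L[ℝ] ℝ) (x : M)
    (u v : TangentSpace 𝓘(ℝ, E) x) : ℝ :=
  (1 / 2) * (d% (fun y ↦ η y (extend E v y)) x u - d% (fun y ↦ η y (extend E u y)) x v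
    - η x (mlieBracket 𝓘(ℝ, E) (extend E u) (extend E v) x))

/-- The value of `η ∧ (dη)ⁿ` on `2n + 1` tangent vectors, up to a positive constant that only
depends on `n`: the alternation of `η ⊗ dη ⊗ ⋯ ⊗ dη`. -/
def contactVolume (n : ℕ) (η : ∀ x : M, TangentSpace 𝓘(ℝ, E) x →L[ℝ] ℝ) (x : M)
    (v : Fin (2 * n + 1) → TangentSpace 𝓘(ℝ, E) x) : ℝ :=
  ∑ σ : Equiv.Perm (Fin (2 * n + 1)), ((Equiv.Perm.sign σ : ℤ) : ℝ) *
    (η x (v (σ 0)) * ∏ i : Fin n, extDerivOneForm η x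
      (v (σ ⟨2 * i + 1, by omega⟩)) (v (σ ⟨2 * i + 2, by omega⟩)))

/-- A paracontact metric structure `(φ, ξ, η, g)` on a manifold `M` of dimension `2n + 1`. -/
structure ParacontactMetricStructure (n : ℕ) (E : Type*) [NormedAddCommGroup E] [NormedSpace ℝ E]
    [FiniteDimensional ℝ E]
    (M : Type*) [TopologicalSpace M] [ChartedSpace E M] [IsManifold 𝓘(ℝ, E) ∞ M] where
  /-- the contact form -/
  η : ∀ x : M, TangentSpace 𝓘(ℝ, E) x →L[ℝ] ℝ
  /-- the Reeb vector field -/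
  ξ : ∀ x : M, TangentSpace 𝓘(ℝ, E) x
  /-- the associated metric -/
  g : SemiRiemannianMetric E M
  /-- the structure tensor of type `(1,1)` -/
  φ : ∀ x : M, TangentSpace 𝓘(ℝ, E) x →L[ℝ] TangentSpace 𝓘(ℝ, E) x
  finrank_eq : Module.finrank ℝ E = 2 * n + 1
  η_smooth : ContMDiff 𝓘(ℝ, E) (𝓘(ℝ, E).prod 𝓘(ℝ, E →L[ℝ] ℝ)) ∞
    (fun x ↦ TotalSpace.mk' (E →L[ℝ] ℝ)
      (E := fun x : M ↦ TangentSpace 𝓘(ℝ, E) x →L[ℝ] ℝ) x (η x))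
  ξ_smooth : ContMDiff 𝓘(ℝ, E) (𝓘(ℝ, E).prod 𝓘(ℝ, E)) ∞
    (fun x ↦ TotalSpace.mk' E (E := fun x : M ↦ TangentSpace 𝓘(ℝ, E) x) x (ξ x))
  φ_smooth : ContMDiff 𝓘(ℝ, E) (𝓘(ℝ, E).prod 𝓘(ℝ, E →L[ℝ] E)) ∞
    (fun x ↦ TotalSpace.mk' (E →L[ℝ] E)
      (E := fun x : M ↦ TangentSpace 𝓘(ℝ, E) x →L[ℝ] TangentSpace 𝓘(ℝ, E) x) x (φ x))
  /-- `η ∧ (dη)ⁿ` vanishes nowhere -/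
  contact : ∀ x : M, ∃ v, contactVolume n η x v ≠ 0
  η_ξ : ∀ x : M, η x (ξ x) = 1
  dη_ξ : ∀ (x : M) (v : TangentSpace 𝓘(ℝ, E) x), extDerivOneForm η x (ξ x) v = 0
  η_eq : ∀ (x : M) (v : TangentSpace 𝓘(ℝ, E) x), η x v = g.val x (ξ x) v
  dη_eq : ∀ (x : M) (v w : TangentSpace 𝓘(ℝ, E) x), extDerivOneForm η x v w = g.val x v (φ x w)
  φ_sq : ∀ (x : M) (v : TangentSpace 𝓘(ℝ, E) x), φ x (φ x v) = v - η x v • ξ x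

namespace ParacontactMetricStructure

variable {n : ℕ} (S : ParacontactMetricStructure n E M)

theorem mdiffAt_φ {X : ∀ x : M, TangentSpace 𝓘(ℝ, E) x} {x : M} (hX : MDiffAt (T% X) x) :
    MDiffAt (T% (fun y ↦ S.φ y (X y))) x :=
  MDifferentiableAt.clm_bundle_apply (F₁ := E) (F₂ := E)
    ((S.φ_smooth x).mdifferentiableAt (by simp)) hX

theorem lieDerivative_tensorial (x : M) :
    TensorialAt 𝓘(ℝ, E) E (fun X : (∀ x : M, TangentSpace 𝓘(ℝ, E) x) ↦
      (1 / 2 : ℝ) • (mlieBracket 𝓘(ℝ, E) S.ξ (fun y ↦ S.φ y (X y)) x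
        - S.φ x (mlieBracket 𝓘(ℝ, E) S.ξ X x))) x where
  smul {f X} hf hX := by
    have : (fun y ↦ S.φ y ((f • X) y)) = f • fun y ↦ S.φ y (X y) := by ext y; simp
    rw [this, mlieBracket_smul_right hf (S.mdiffAt_φ hX), mlieBracket_smul_right hf hX]
    simp
    module
  add {X X'} hX hX' := by
    have : (fun y ↦ S.φ y ((X + X') y)) = (fun y ↦ S.φ y (X y)) + fun y ↦ S.φ y (X' y) := by
      ext y; simp
    rw [this, mlieBracket_add_right (S.mdiffAt_φ hX) (S.mdiffAt_φ hX'),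
      mlieBracket_add_right hX hX']
    simp
    module

/-- The tensor `h = ½ L_ξ φ`, that is, `h X = ½ ([ξ, φ X] - φ [ξ, X])`. -/
def h (x : M) : TangentSpace 𝓘(ℝ, E) x →L[ℝ] TangentSpace 𝓘(ℝ, E) x :=
  TensorialAt.mkHom (fun X : (∀ x : M, TangentSpace 𝓘(ℝ, E) x) ↦
    (1 / 2 : ℝ) • (mlieBracket 𝓘(ℝ, E) S.ξ (fun y ↦ S.φ y (X y)) x
      - S.φ x (mlieBracket 𝓘(ℝ, E) S.ξ X x))) x (S.lieDerivative_tensorial x)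

/-- The trace of `h²`. -/
def traceHSq (x : M) : ℝ :=
  LinearMap.trace ℝ (TangentSpace 𝓘(ℝ, E) x) ((S.h x).toLinearMap ∘ₗ (S.h x).toLinearMap)

/-- The projection onto `ker η`, along the orthogonal complement spanned by `ξ`. -/
def kerProj (x : M) (v : TangentSpace 𝓘(ℝ, E) x) : TangentSpace 𝓘(ℝ, E) x :=
  v - S.η x v • S.ξ x

end ParacontactMetricStructure

end Paracontact

end

/-!
Write `A = ∇ξ` for the endomorphism field `v ↦ ∇_v ξ`. The identity `dη(u, v) = g(u, φ v)` says that
`-φ` is the skew-adjoint part of `A`, so the adjoint of `A` is `A + 2φ`; moreover `A ξ = 0` and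
`g(A u, ξ) = 0`.

*Curvature.* For any vector field `V` the Ricci identity gives
`R_{uv} V = (∇_v ∇V) u - (∇_u ∇V) v`. Since `R` is skew in its last two slots, the first Bianchi
identity turns the Ricci tensor into `ϱ(V, w) = tr (u ↦ (∇_u ∇V) w) - tr (∇_w ∇V)`
(`ricci_eq_trace`), and it also shows that the fundamental form `g(·, φ ·)` is closed. Both rest on
the smoothness of the Levi-Civita connection (`smooth_leviCivita`) and on the fact that brackets act
on functions as commutators (`mvfderiv_mlieBracket`).

*Algebra at a point.* Closedness together with the derivative of `φ² = 1 - η ⊗ ξ` along `ξ` yields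
`∇_ξ φ = 0` and `A φ + φ A = -2φ²` (`Dφ_ξ`, `A_φ_add`). Hence `h = ½ (φ A - A φ)` and
`h² = φ² - A²`, and `‖∇ξ‖² = tr (A* A) = tr A² + 2 tr (φ A) = -(2n + tr h²)` (`sum_apply_A_A`).
The same relations give `tr A = 0`, `tr (∇_w A) = 0` (`trace_DA`) and `div φ = -2n ξ`
(`trace_flip_Dφ`).

*Conclusion.* As `tr (∇_w A) = 0`, `ϱ(ξ, w) = tr (u ↦ (∇_u A) w)`, which is the product of `w` with
the divergence of `A* = A + 2φ`. This divergence is `-Δ̄ξ - 4n ξ`, so `Δ̄ξ = -4n ξ - Qξ`.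
Differentiating `g(A u, ξ) = 0` shows `g(Δ̄ξ, ξ) = ‖∇ξ‖²`, which gives the second form of `Δ̄ξ`.
-/

open scoped Topology

noncomputable section

namespace Paracontact

open VectorField FiberBundle Bundle

variable {E : Type*} [NormedAddCommGroup E] [NormedSpace ℝ E] [FiniteDimensional ℝ E]
  {M : Type*} [TopologicalSpace M] [ChartedSpace E M] [IsManifold 𝓘(ℝ, E) ∞ M]

/-! ### Smooth vector fields and directional derivatives -/

theorem mdiffAt_of_smooth {X : ∀ y : M, TangentSpace 𝓘(ℝ, E) y} {x : M}
    (hX : CMDiffAt ∞ (T% X) x) : MDiffAt (T% X) x :=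
  hX.mdifferentiableAt (by simp)

theorem eventually_mdiffAt_of_smooth {X : ∀ y : M, TangentSpace 𝓘(ℝ, E) y} {x : M}
    (hX : CMDiffAt ∞ (T% X) x) : ∀ᶠ y in 𝓝 x, MDiffAt (T% X) y := by
  have h1 : CMDiffAt 1 (T% X) x := hX.of_le (by simp)
  filter_upwards [(contMDiffAt_iff_contMDiffAt_nhds (by simp)).1 h1] with y hy
  exact hy.mdifferentiableAt (by simp)

theorem eventually_mdiffAt_of_smooth_fun {f : M → ℝ} {x : M} (hf : CMDiffAt ∞ f x) :
    ∀ᶠ y in 𝓝 x, MDiffAt f y := by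
  filter_upwards [(contMDiffAt_iff_contMDiffAt_nhds (n := 1) (by simp)).1
    (hf.of_le (by simp))] with y hy
  exact hy.mdifferentiableAt (by simp)

theorem smooth_extend {x : M} (v : TangentSpace 𝓘(ℝ, E) x) :
    CMDiffAt ∞ (T% (extend E v)) x :=
  contMDiffAt_extend 𝓘(ℝ, E) E v

theorem smooth_mlieBracket {X Y : ∀ y : M, TangentSpace 𝓘(ℝ, E) y} {x : M}
    (hX : CMDiffAt ∞ (T% X) x) (hY : CMDiffAt ∞ (T% Y) x) :
    CMDiffAt ∞ (T% (mlieBracket 𝓘(ℝ, E) X Y)) x := by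
  have : IsManifold 𝓘(ℝ, E) (((⊤ : ℕ∞) : WithTop ℕ∞) + 1) M :=
    inferInstanceAs (IsManifold 𝓘(ℝ, E) ∞ M)
  have : IsManifold 𝓘(ℝ, E) (minSmoothness ℝ 2) M := by
    rw [minSmoothness_of_isRCLikeNormedField]; infer_instance
  exact ContMDiffAt.mlieBracket_vectorField (m := ⊤) (n := ⊤) hX hY (by simp)

theorem leibniz_mlieBracket {X Y Z : ∀ y : M, TangentSpace 𝓘(ℝ, E) y} {x : M}
    (hX : CMDiffAt ∞ (T% X) x) (hY : CMDiffAt ∞ (T% Y) x) (hZ : CMDiffAt ∞ (T% Z) x) :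
    mlieBracket 𝓘(ℝ, E) X (mlieBracket 𝓘(ℝ, E) Y Z) x =
      mlieBracket 𝓘(ℝ, E) (mlieBracket 𝓘(ℝ, E) X Y) Z x +
        mlieBracket 𝓘(ℝ, E) Y (mlieBracket 𝓘(ℝ, E) X Z) x := by
  have : IsManifold 𝓘(ℝ, E) (minSmoothness ℝ 3) M := by
    rw [minSmoothness_of_isRCLikeNormedField]; infer_instance
  have h2 : minSmoothness ℝ 2 ≤ (∞ : WithTop ℕ∞) := by
    rw [minSmoothness_of_isRCLikeNormedField]; exact WithTop.coe_le_coe.2 le_top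
  exact leibniz_identity_mlieBracket_apply (hX.of_le h2) (hY.of_le h2) (hZ.of_le h2)

/-- The derivative of a smooth function along a smooth field is smooth. For a frame field `W`, it is
the `W`-component of `[X, f W] - f [X, W]`. -/
theorem smooth_mvfderiv_apply {f : M → ℝ} {X : ∀ y : M, TangentSpace 𝓘(ℝ, E) y} {x : M}
    (hf : CMDiffAt ∞ f x) (hX : CMDiffAt ∞ (T% X) x) :
    CMDiffAt ∞ (fun y ↦ d% f y (X y)) x := by
  rcases subsingleton_or_nontrivial E with hE | hE
  · have : (fun y ↦ d% f y (X y)) = fun _ ↦ (0 : ℝ) := by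
      ext y
      have : Subsingleton (TangentSpace 𝓘(ℝ, E) y) := hE
      rw [Subsingleton.elim (X y) 0, map_zero]
    rw [this]
    exact contMDiffAt_const
  · let b := Module.finBasis ℝ E
    let i : Fin (Module.finrank ℝ E) := ⟨0, Module.finrank_pos⟩
    let t := trivializationAt E (TangentSpace 𝓘(ℝ, E)) x
    have hx : x ∈ t.baseSet := mem_baseSet_trivializationAt' x
    let W := t.localFrame b i
    have hW : ∀ y ∈ t.baseSet, CMDiffAt ∞ (T% W) y := fun y hy ↦
      contMDiffAt_localFrame_of_mem ∞ t b i hy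
    have hfW : CMDiffAt ∞ (T% (f • W)) x := hf.smul_section (hW x hx)
    have h1 : CMDiffAt ∞ (T% (mlieBracket 𝓘(ℝ, E) X (f • W) - f • mlieBracket 𝓘(ℝ, E) X W)) x :=
      (smooth_mlieBracket hX hfW).sub_section (hf.smul_section (smooth_mlieBracket hX (hW x hx)))
    refine (contMDiffAt_localFrameCoeff b hx h1 i).congr_of_eventuallyEq ?_
    have hf' := eventually_mdiffAt_of_smooth_fun hf
    filter_upwards [hf', t.open_baseSet.mem_nhds hx] with y hy hyt
    change _ = t.localFrameCoeff 𝓘(ℝ, E) b i y (mlieBracket 𝓘(ℝ, E) X (f • W) y -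
      f y • mlieBracket 𝓘(ℝ, E) X W y)
    rw [mlieBracket_smul_right hy (mdiffAt_of_smooth (hW y hyt))]
    have hc : t.localFrameCoeff 𝓘(ℝ, E) b i y (W y) = 1 := by
      rw [t.localFrameCoeff_apply_of_mem_baseSet b hyt]
      simp [W, t.localFrame_apply_of_mem_baseSet b hyt]
    simp [hc]

/-- The Lie bracket acts on functions as the commutator of derivations. This is the `W`-component of
the Jacobi identity for `X`, `Y` and `f W`, where `W` does not vanish at `x`. -/
theorem mvfderiv_mlieBracket {f : M → ℝ} {X Y : ∀ y : M, TangentSpace 𝓘(ℝ, E) y} {x : M}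
    (hf : CMDiffAt ∞ f x) (hX : CMDiffAt ∞ (T% X) x) (hY : CMDiffAt ∞ (T% Y) x) :
    d% f x (mlieBracket 𝓘(ℝ, E) X Y x) =
      d% (fun y ↦ d% f y (Y y)) x (X x) - d% (fun y ↦ d% f y (X y)) x (Y x) := by
  rcases subsingleton_or_nontrivial E with hE | hE
  · have : Subsingleton (TangentSpace 𝓘(ℝ, E) x) := hE
    rw [Subsingleton.elim (mlieBracket 𝓘(ℝ, E) X Y x) 0, Subsingleton.elim (X x) 0,
      Subsingleton.elim (Y x) 0]
    simp
  obtain ⟨w, hw⟩ : ∃ w : TangentSpace 𝓘(ℝ, E) x, w ≠ 0 := exists_ne (α := E) 0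
  let W := extend E w
  have hW : CMDiffAt ∞ (T% W) x := smooth_extend w
  have hf' := eventually_mdiffAt_of_smooth_fun hf
  have key : ∀ {U V : ∀ y : M, TangentSpace 𝓘(ℝ, E) y}, CMDiffAt ∞ (T% U) x →
      CMDiffAt ∞ (T% V) x → mlieBracket 𝓘(ℝ, E) U (mlieBracket 𝓘(ℝ, E) V (f • W)) x =
        d% (fun y ↦ d% f y (V y)) x (U x) • w + d% f x (V x) • mlieBracket 𝓘(ℝ, E) U W x
          + (d% f x (U x) • mlieBracket 𝓘(ℝ, E) V W x
            + f x • mlieBracket 𝓘(ℝ, E) U (mlieBracket 𝓘(ℝ, E) V W) x) := by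
    intro U V hU hV
    have hev : mlieBracket 𝓘(ℝ, E) V (f • W) =ᶠ[𝓝 x]
        (fun y ↦ d% f y (V y)) • W + f • mlieBracket 𝓘(ℝ, E) V W := by
      filter_upwards [hf', eventually_mdiffAt_of_smooth hW] with y hy hyW
      rw [mlieBracket_smul_right hy hyW]
      rfl
    have hdf := smooth_mvfderiv_apply hf hV
    have hVW := smooth_mlieBracket hV hW
    rw [Filter.EventuallyEq.mlieBracket_vectorField_eq (Filter.EventuallyEq.refl _ U) hev,
      mlieBracket_add_right (mdiffAt_of_smooth (hdf.smul_section hW))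
        (mdiffAt_of_smooth (hf.smul_section hVW)),
      mlieBracket_smul_right (hdf.mdifferentiableAt (by simp)) (mdiffAt_of_smooth hW),
      mlieBracket_smul_right (hf.mdifferentiableAt (by simp)) (mdiffAt_of_smooth hVW)]
    simp [W]
  have hJ := leibniz_mlieBracket hX hY (hf.smul_section hW)
  have hJ' := leibniz_mlieBracket hX hY hW
  rw [key hX hY, key hY hX, mlieBracket_smul_right (hf.mdifferentiableAt (by simp))
    (mdiffAt_of_smooth hW), hJ'] at hJ
  have h0 : (d% f x (mlieBracket 𝓘(ℝ, E) X Y x) -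
      (d% (fun y ↦ d% f y (Y y)) x (X x) - d% (fun y ↦ d% f y (X y)) x (Y x))) • w = 0 := by
    simp only [W, extend_apply_self] at hJ
    rw [← sub_eq_zero] at hJ
    rw [← neg_eq_zero, ← hJ]
    module
  exact sub_eq_zero.1 ((smul_eq_zero.1 h0).resolve_right hw)

theorem smooth_det {ι : Type*} [Fintype ι] [DecidableEq ι] {G : M → Matrix ι ι ℝ} {x : M}
    (hG : ∀ i j, CMDiffAt ∞ (fun y ↦ G y i j) x) : CMDiffAt ∞ (fun y ↦ (G y).det) x := by
  simp only [Matrix.det_apply']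
  exact contMDiffAt_finsetSum fun σ _ ↦ contMDiffAt_const.mul
    (contMDiffAt_finsetProd fun i _ ↦ hG (σ i) i)

/-! ### Smoothness of the Levi-Civita connection -/

namespace SemiRiemannianMetric

variable (g : SemiRiemannianMetric E M)

theorem smooth_val {X Y : ∀ y : M, TangentSpace 𝓘(ℝ, E) y} {x : M}
    (hX : CMDiffAt ∞ (T% X) x) (hY : CMDiffAt ∞ (T% Y) x) :
    CMDiffAt ∞ (fun y ↦ g.val y (X y) (Y y)) x := by
  have : ContMDiffAt 𝓘(ℝ, E) (𝓘(ℝ, E).prod 𝓘(ℝ)) ∞ (fun m ↦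
      TotalSpace.mk' ℝ (E := Bundle.Trivial M ℝ) m (g.val m (X m) (Y m))) x :=
    ContMDiffAt.clm_bundle_apply₂ (F₁ := E) (F₂ := E) (g.contMDiff x) hX hY
  simpa [contMDiffAt_section] using this

/-- A vector field is smooth as soon as its products with all smooth fields are: by Cramer's rule,
its components in a local frame are quotients of determinants in those products. -/
theorem smooth_of_smooth_val {V : ∀ y : M, TangentSpace 𝓘(ℝ, E) y} {x : M}
    (h : ∀ Z : (∀ y : M, TangentSpace 𝓘(ℝ, E) y), CMDiffAt ∞ (T% Z) x →
      CMDiffAt ∞ (fun y ↦ g.val y (V y) (Z y)) x) : CMDiffAt ∞ (T% V) x := by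
  let b := Module.finBasis ℝ E
  let t := trivializationAt E (TangentSpace 𝓘(ℝ, E)) x
  have hx : x ∈ t.baseSet := mem_baseSet_trivializationAt' x
  let s := t.localFrame b
  have hs : ∀ i, CMDiffAt ∞ (T% (s i)) x := fun i ↦ contMDiffAt_localFrame_of_mem ∞ t b i hx
  let G : M → Matrix (Fin (Module.finrank ℝ E)) (Fin (Module.finrank ℝ E)) ℝ :=
    fun y ↦ Matrix.of fun i j ↦ g.val y (s i y) (s j y)
  have hG : ∀ i j, CMDiffAt ∞ (fun y ↦ G y i j) x := fun i j ↦ g.smooth_val (hs i) (hs j)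
  have hdet : ∀ y ∈ t.baseSet, (G y).det ≠ 0 := by
    intro y hy
    have hGy : G y = LinearMap.BilinForm.toMatrix (t.basisAt b hy) (g.bilin y) := by
      ext i j
      simp [G, s, LinearMap.BilinForm.toMatrix_apply, t.localFrame_apply_of_mem_baseSet b hy,
        bilin]
    rw [hGy]
    exact (LinearMap.BilinForm.nondegenerate_iff_det_ne_zero (t.basisAt b hy)).1
      (g.bilin_nondegenerate y)
  let w : M → Fin (Module.finrank ℝ E) → ℝ := fun y i ↦ g.val y (V y) (s i y)
  refine (contMDiffAt_iff_localFrameCoeff b hx).2 fun i ↦ ?_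
  have h2 : CMDiffAt ∞ (fun y ↦ ((G y).updateCol i (w y)).det * ((G y).det)⁻¹) x := by
    refine (smooth_det fun j k ↦ ?_).mul ((smooth_det hG).inv₀ (hdet x hx))
    by_cases hk : k = i
    · subst hk
      simpa using h (s j) (hs j)
    · simpa [Matrix.updateCol_ne hk] using hG j k
  refine h2.congr_of_eventuallyEq ?_
  filter_upwards [t.open_baseSet.mem_nhds hx] with y hy
  rw [LinearMap.piApply_apply, eq_mul_inv_iff_mul_eq₀ (hdet y hy)]
  let c : Fin (Module.finrank ℝ E) → ℝ := fun j ↦ t.localFrameCoeff 𝓘(ℝ, E) b j y (V y)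
  have hV : V y = ∑ j, c j • s j y := t.eq_sum_localFrameCoeff_smul hy
  have hw : w y = (G y).mulVec c := by
    ext j
    simp only [w, hV, Matrix.mulVec, dotProduct, G, Matrix.of_apply]
    rw [g.symm]
    simp [mul_comm]
  rw [← Matrix.cramer_apply, Matrix.cramer_eq_adjugate_mulVec, hw, Matrix.mulVec_mulVec,
    Matrix.adjugate_mul, Matrix.smul_mulVec, Matrix.one_mulVec]
  simp [c, mul_comm]

theorem smooth_leviCivita {X Y : ∀ y : M, TangentSpace 𝓘(ℝ, E) y} {x : M}
    (hX : CMDiffAt ∞ (T% X) x) (hY : CMDiffAt ∞ (T% Y) x) :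
    CMDiffAt ∞ (T% (fun y ↦ g.leviCivita Y y (X y))) x := by
  refine g.smooth_of_smooth_val fun Z hZ ↦ ?_
  have h1 : CMDiffAt ∞ (g.koszul X Y Z) x :=
    (((((smooth_mvfderiv_apply (g.smooth_val hY hZ) hX).add
      (smooth_mvfderiv_apply (g.smooth_val hX hZ) hY)).sub
      (smooth_mvfderiv_apply (g.smooth_val hX hY) hZ)).add
      (g.smooth_val (smooth_mlieBracket hX hY) hZ)).sub
      (g.smooth_val (smooth_mlieBracket hX hZ) hY)).sub
      (g.smooth_val (smooth_mlieBracket hY hZ) hX)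
  refine (contMDiffAt_const (c := (1 / 2 : ℝ)).mul h1).congr_of_eventuallyEq ?_
  filter_upwards [eventually_mdiffAt_of_smooth hX, eventually_mdiffAt_of_smooth hY,
    eventually_mdiffAt_of_smooth hZ] with y hyX hyY hyZ
  have := g.two_mul_nabla hyX hyY hyZ
  change g.val y (g.nabla Y y (X y)) (Z y) = 1 / 2 * g.koszul X Y Z y
  linarith

theorem leviCivita_congr {Y Y' : ∀ y : M, TangentSpace 𝓘(ℝ, E) y} {x : M}
    (hY : MDiffAt (T% Y) x) (hY' : MDiffAt (T% Y') x) (h : Y =ᶠ[𝓝 x] Y') :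
    g.leviCivita Y x = g.leviCivita Y' x :=
  g.leviCivita.isCovariantDerivativeOn.congr_of_eventuallyEq hY hY' Filter.univ_mem h

theorem leviCivita_add {Y Y' : ∀ y : M, TangentSpace 𝓘(ℝ, E) y} {x : M}
    (hY : MDiffAt (T% Y) x) (hY' : MDiffAt (T% Y') x) :
    g.leviCivita (fun y ↦ Y y + Y' y) x = g.leviCivita Y x + g.leviCivita Y' x :=
  g.leviCivita.isCovariantDerivativeOn.add hY hY' (Set.mem_univ x)

theorem leviCivita_smul {f : M → ℝ} {Y : ∀ y : M, TangentSpace 𝓘(ℝ, E) y} {x : M}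
    (hf : MDiffAt f x) (hY : MDiffAt (T% Y) x) (v : TangentSpace 𝓘(ℝ, E) x) :
    g.leviCivita (fun y ↦ f y • Y y) x v = f x • g.leviCivita Y x v + d% f x v • Y x := by
  have := g.leviCivita.isCovariantDerivativeOn.leibniz hY hf (Set.mem_univ x)
  exact congrArg (fun T ↦ T v) this

theorem leviCivita_const_smul (c : ℝ) {Y : ∀ y : M, TangentSpace 𝓘(ℝ, E) y} {x : M}
    (hY : MDiffAt (T% Y) x) :
    g.leviCivita (fun y ↦ c • Y y) x = c • g.leviCivita Y x :=
  g.leviCivita.isCovariantDerivativeOn.smul_const c hY (Set.mem_univ x)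

end SemiRiemannianMetric

/-! ### Traces and bilinear forms -/

namespace PointwiseAlgebra

variable {V : Type*} [AddCommGroup V] [Module ℝ V] [FiniteDimensional ℝ V]
  {B : LinearMap.BilinForm ℝ V}

theorem apply_dualBasis_eq_repr {ι : Type*} [Fintype ι] [DecidableEq ι] (hB : B.Nondegenerate)
    (hs : B.IsSymm) (b : Module.Basis ι ℝ V) (v : V) (i : ι) :
    B v (B.dualBasis hB b i) = b.repr v i := by
  conv_lhs => rw [hs.eq, ← b.sum_repr v]
  simp only [map_sum, map_smul, LinearMap.BilinForm.apply_dualBasis_left, smul_eq_mul, mul_ite,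
    mul_one, mul_zero, Finset.sum_ite_eq', Finset.mem_univ, if_true]

theorem sum_apply_dualBasis {ι : Type*} [Fintype ι] [DecidableEq ι] (hB : B.Nondegenerate)
    (hs : B.IsSymm) (b : Module.Basis ι ℝ V) (T : Module.End ℝ V) :
    ∑ i, B (T (b i)) (B.dualBasis hB b i) = LinearMap.trace ℝ V T := by
  rw [LinearMap.trace_eq_matrix_trace ℝ b, Matrix.trace]
  exact Finset.sum_congr rfl fun i _ ↦ by
    rw [apply_dualBasis_eq_repr hB hs, Matrix.diag_apply, LinearMap.toMatrix_apply]

/-- The vector representing a linear form `f` is `∑ᵢ f(bᵢ) bⁱ`. -/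
theorem apply_sum_smul_dualBasis {ι : Type*} [Fintype ι] [DecidableEq ι] (hB : B.Nondegenerate)
    (hs : B.IsSymm) (b : Module.Basis ι ℝ V) (f : V →ₗ[ℝ] ℝ) (w : V) :
    B (∑ i, f (b i) • B.dualBasis hB b i) w = f w := by
  conv_rhs => rw [← b.sum_repr w, map_sum]
  rw [hs.eq, map_sum]
  refine Finset.sum_congr rfl fun i _ ↦ ?_
  rw [map_smul, map_smul, apply_dualBasis_eq_repr hB hs, smul_eq_mul, smul_eq_mul, mul_comm]

theorem trace_eq_of_adjoint (hB : B.Nondegenerate) (hs : B.IsSymm) {T T' : Module.End ℝ V}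
    (h : ∀ u v, B (T u) v = B u (T' v)) : LinearMap.trace ℝ V T = LinearMap.trace ℝ V T' := by
  have h1 : (B.toDual hB).conj T' = Module.Dual.transpose (R := ℝ) T := by
    ext f v
    obtain ⟨u, rfl⟩ := (B.toDual hB).surjective f
    rw [LinearEquiv.conj_apply_apply, LinearEquiv.symm_apply_apply]
    change B (T' u) v = B u (T v)
    rw [hs.eq, ← h, hs.eq]
  rw [← LinearMap.trace_conj' T' (B.toDual hB), h1]
  exact (LinearMap.congr_fun (LinearMap.trace_transpose ℝ V) T).symm

theorem trace_eq_zero_of_skew (hB : B.Nondegenerate) (hs : B.IsSymm) {T : Module.End ℝ V}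
    (h : ∀ u v, B (T u) v = -B u (T v)) : LinearMap.trace ℝ V T = 0 := by
  have := trace_eq_of_adjoint hB hs (T := T) (T' := -T) fun u v ↦ by
    rw [h, LinearMap.neg_apply, map_neg]
  rw [map_neg] at this
  linarith

theorem eq_of_forall_left {u v : V} (hB : B.Nondegenerate) (h : ∀ w, B u w = B v w) : u = v := by
  rw [← sub_eq_zero]
  exact hB.1 _ fun w ↦ by rw [map_sub, LinearMap.sub_apply, h, sub_self]

/-! ### The algebra of a paracontact metric structure at a point -/

/-- The identities that the covariant derivatives of the structure tensors of a paracontact metric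
structure satisfy at one point: `B` is the metric, `A` stands for `∇ξ`, `DA u` for `∇_u (∇ξ)` and
`Dφ u` for `∇_u φ`. -/
structure ParacontactIdentities (B : LinearMap.BilinForm ℝ V) (ξ : V) (A φ : Module.End ℝ V)
    (DA Dφ : V →ₗ[ℝ] Module.End ℝ V) : Prop where
  symm : B.IsSymm
  nondegenerate : B.Nondegenerate
  ξ_ξ : B ξ ξ = 1
  φ_sq : ∀ v, φ (φ v) = v - B ξ v • ξ
  /-- `dη(u, v) = g(u, φ v)` in terms of `∇ξ` -/
  apply_φ : ∀ u v, B u (φ v) = (1 / 2) * (B (A u) v - B (A v) u)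
  apply_A_ξ : ∀ u, B (A u) ξ = 0
  φ_ξ : φ ξ = 0
  /-- covariant derivative of `apply_φ` -/
  apply_Dφ : ∀ w u v, B u (Dφ w v) = (1 / 2) * (B (DA w u) v - B (DA w v) u)
  /-- covariant derivative of `φ_sq` -/
  Dφ_φ : ∀ w v, Dφ w (φ v) + φ (Dφ w v) = -(B (A w) v • ξ) - B ξ v • A w
  /-- the fundamental 2-form is closed -/
  cyclic : ∀ u v w, B v (Dφ u w) + B w (Dφ v u) + B u (Dφ w v) = 0
  /-- covariant derivative of `apply_A_ξ` -/
  apply_DA_ξ : ∀ w u, B (DA w u) ξ = -B (A u) (A w)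

namespace ParacontactIdentities

variable {ξ : V} {A φ : Module.End ℝ V} {DA Dφ : V →ₗ[ℝ] Module.End ℝ V}

theorem φ_skew (h : ParacontactIdentities B ξ A φ DA Dφ) (u v : V) : B (φ u) v = -B u (φ v) := by
  rw [h.symm.eq, h.apply_φ, h.apply_φ]; ring

theorem Dφ_skew (h : ParacontactIdentities B ξ A φ DA Dφ) (w u v : V) :
    B (Dφ w u) v = -B u (Dφ w v) := by
  rw [h.symm.eq, h.apply_Dφ, h.apply_Dφ]; ring

theorem A_ξ (h : ParacontactIdentities B ξ A φ DA Dφ) : A ξ = 0 := by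
  refine eq_of_forall_left h.nondegenerate fun v ↦ ?_
  have h1 := h.apply_φ ξ v
  rw [h.apply_A_ξ, ← neg_eq_iff_eq_neg.2 (h.φ_skew ξ v), h.φ_ξ] at h1
  simp only [map_zero, LinearMap.zero_apply, neg_zero] at h1 ⊢
  linarith

theorem ξ_φ (h : ParacontactIdentities B ξ A φ DA Dφ) (v : V) : B ξ (φ v) = 0 := by
  have := h.φ_skew ξ v
  rw [h.φ_ξ] at this
  simpa using this.symm

theorem ξ_A (h : ParacontactIdentities B ξ A φ DA Dφ) (v : V) : B ξ (A v) = 0 := by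
  rw [h.symm.eq, h.apply_A_ξ]

/-- The adjoint of `∇ξ` is `∇ξ + 2φ`. -/
theorem A_adjoint (h : ParacontactIdentities B ξ A φ DA Dφ) (u v : V) :
    B (A u) v = B u (A v + (2 : ℝ) • φ v) := by
  rw [map_add, map_smul, h.apply_φ, h.symm.eq u (A v), smul_eq_mul]; ring

theorem φ_cube (h : ParacontactIdentities B ξ A φ DA Dφ) (v : V) : φ (φ (φ v)) = φ v := by
  rw [h.φ_sq, h.ξ_φ, zero_smul, sub_zero]

theorem A_φ_sq (h : ParacontactIdentities B ξ A φ DA Dφ) (v : V) : A (φ (φ v)) = A v := by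
  rw [h.φ_sq, map_sub, map_smul, h.A_ξ, smul_zero, sub_zero]

theorem φ_sq_A (h : ParacontactIdentities B ξ A φ DA Dφ) (v : V) : φ (φ (A v)) = A v := by
  rw [h.φ_sq, h.ξ_A, zero_smul, sub_zero]

theorem Dφ_apply_ξ (h : ParacontactIdentities B ξ A φ DA Dφ) (w : V) : Dφ w ξ = -φ (A w) := by
  have h1 := congrArg φ (h.Dφ_φ w ξ)
  have h2 : B ξ (Dφ w ξ) = 0 := by
    have := h.Dφ_skew w ξ ξ
    rw [h.symm.eq] at this
    linarith
  rw [h.φ_ξ, h.apply_A_ξ, h.ξ_ξ, map_zero, zero_add, h.φ_sq, h2] at h1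
  simpa using h1

theorem Dφ_ξ_eq (h : ParacontactIdentities B ξ A φ DA Dφ) (v : V) :
    Dφ ξ v = -(A (φ v) + φ (A v) + (2 : ℝ) • φ (φ v)) := by
  refine eq_of_forall_left h.nondegenerate fun u ↦ ?_
  have h1 := h.cyclic ξ u v
  have h2 : B v (Dφ u ξ) = B u (A (φ v) + (2 : ℝ) • φ (φ v)) := by
    rw [h.Dφ_apply_ξ, map_neg, ← h.φ_skew, h.symm.eq, h.A_adjoint]
  have h3 : B ξ (Dφ v u) = B u (φ (A v)) := by
    rw [← neg_eq_iff_eq_neg.2 (h.Dφ_skew v ξ u), h.Dφ_apply_ξ, map_neg, LinearMap.neg_apply, neg_neg,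
      h.symm.eq]
  rw [h2, h3] at h1
  rw [h.symm.eq, h.symm.eq _ u]
  simp only [map_neg, map_add, map_smul, smul_eq_mul] at h1 ⊢
  linarith

/-- The symmetric part of `∇ξ` anticommutes with `φ`. -/
theorem A_φ_add (h : ParacontactIdentities B ξ A φ DA Dφ) (v : V) :
    A (φ v) + φ (A v) = -((2 : ℝ) • φ (φ v)) := by
  have h1 : ∀ v, φ (A (φ v)) = -A v - (2 : ℝ) • φ v := by
    intro v
    have := h.Dφ_φ ξ v
    rw [h.A_ξ, h.Dφ_ξ_eq, h.Dφ_ξ_eq] at this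
    simp only [map_neg, map_add, map_smul, h.A_φ_sq, h.φ_cube, h.φ_sq_A, map_zero,
      LinearMap.zero_apply, zero_smul, smul_zero, neg_zero, sub_zero] at this
    have h2 : (2 : ℝ) • φ (A (φ v)) = (2 : ℝ) • (-A v - (2 : ℝ) • φ v) := by
      rw [← sub_eq_zero, ← neg_eq_zero, ← this]; module
    exact smul_right_injective V (two_ne_zero (α := ℝ)) h2
  have h3 := congrArg φ (h1 v)
  rw [h.φ_sq_A, map_sub, map_neg, map_smul] at h3
  rw [h3]; module

theorem Dφ_ξ (h : ParacontactIdentities B ξ A φ DA Dφ) (v : V) : Dφ ξ v = 0 := by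
  rw [h.Dφ_ξ_eq, h.A_φ_add]; module

theorem Dφ_mul_add (h : ParacontactIdentities B ξ A φ DA Dφ) (w : V) :
    Dφ w * φ + φ * Dφ w = -(B (A w)).smulRight ξ - (B ξ).smulRight (A w) :=
  LinearMap.ext fun v ↦ h.Dφ_φ w v

theorem trace_mul_Dφ_mul_add (h : ParacontactIdentities B ξ A φ DA Dφ) (S : Module.End ℝ V)
    (w : V) : LinearMap.trace ℝ V (S * (Dφ w * φ + φ * Dφ w)) =
      -B (A w) (S ξ) - B ξ (S (A w)) := by
  have : S * (Dφ w * φ + φ * Dφ w) =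
      -(B (A w)).smulRight (S ξ) - (B ξ).smulRight (S (A w)) := by
    rw [h.Dφ_mul_add]
    ext v
    simp
  rw [this, map_sub, map_neg, LinearMap.trace_smulRight, LinearMap.trace_smulRight]

theorem φ_mul_φ (h : ParacontactIdentities B ξ A φ DA Dφ) :
    φ * φ = 1 - (B ξ).smulRight ξ :=
  LinearMap.ext fun v ↦ h.φ_sq v

theorem trace_φ_sq (h : ParacontactIdentities B ξ A φ DA Dφ) :
    LinearMap.trace ℝ V (φ * φ) = Module.finrank ℝ V - 1 := by
  rw [h.φ_mul_φ, map_sub, LinearMap.trace_smulRight, LinearMap.trace_one, h.ξ_ξ]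

theorem trace_φ_mul_A (h : ParacontactIdentities B ξ A φ DA Dφ) :
    LinearMap.trace ℝ V (φ * A) = -(Module.finrank ℝ V - 1) := by
  have h1 : A * φ + φ * A = -((2 : ℝ) • (φ * φ)) := LinearMap.ext fun v ↦ h.A_φ_add v
  have h2 := congrArg (LinearMap.trace ℝ V) h1
  rw [map_add, LinearMap.trace_mul_comm, map_neg, map_smul, h.trace_φ_sq, smul_eq_mul] at h2
  linarith

/-- The trace of `∇_w (∇ξ)` vanishes. The hypothesis is the covariant derivative of `A_φ_add`. -/
theorem trace_DA (h : ParacontactIdentities B ξ A φ DA Dφ) (w : V)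
    (hw : ∀ v, DA w (φ v) + A (Dφ w v) + (Dφ w (A v) + φ (DA w v)) =
      -((2 : ℝ) • (Dφ w (φ v) + φ (Dφ w v)))) :
    LinearMap.trace ℝ V (DA w) = 0 := by
  have h1 : DA w * φ * φ + A * (Dφ w * φ) + (Dφ w * (A * φ) + φ * (DA w * φ)) =
      -((2 : ℝ) • ((Dφ w * φ + φ * Dφ w) * φ)) := LinearMap.ext fun v ↦ hw (φ v)
  have h2 : LinearMap.trace ℝ V (A * (Dφ w * φ)) + LinearMap.trace ℝ V (Dφ w * (A * φ)) = 0 := by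
    have := h.trace_mul_Dφ_mul_add A w
    rw [mul_add, map_add, ← mul_assoc A φ, LinearMap.trace_mul_comm _ (A * φ), h.A_ξ, h.ξ_A] at this
    simpa using this
  have h3 : LinearMap.trace ℝ V ((Dφ w * φ + φ * Dφ w) * φ) = 0 := by
    rw [LinearMap.trace_mul_comm, h.trace_mul_Dφ_mul_add, h.φ_ξ, h.ξ_φ]
    simp
  have h4 : LinearMap.trace ℝ V (DA w * φ * φ) = LinearMap.trace ℝ V (DA w) := by
    have h5 : DA w * φ * φ = DA w - (B ξ).smulRight (DA w ξ) := by
      rw [mul_assoc, h.φ_mul_φ]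
      ext v
      simp
    have h6 : B ξ (DA w ξ) = 0 := by
      rw [h.symm.eq, h.apply_DA_ξ, h.A_ξ]
      simp
    rw [h5, map_sub, LinearMap.trace_smulRight, h6, sub_zero]
  have h7 := congrArg (LinearMap.trace ℝ V) h1
  rw [map_add, map_add, map_add, map_neg, map_smul, h3, LinearMap.trace_mul_comm ℝ φ, h4] at h7
  simp only [smul_zero, neg_zero] at h7
  linarith

theorem trace_A (h : ParacontactIdentities B ξ A φ DA Dφ) : LinearMap.trace ℝ V A = 0 := by
  have h1 : A * φ * φ + φ * A * φ = -((2 : ℝ) • (φ * φ * φ)) :=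
    LinearMap.ext fun v ↦ h.A_φ_add (φ v)
  have h2 : A * φ * φ = A := LinearMap.ext fun v ↦ h.A_φ_sq v
  have h3 : φ * φ * φ = φ := LinearMap.ext fun v ↦ h.φ_cube v
  have h4 : LinearMap.trace ℝ V φ = 0 := trace_eq_zero_of_skew h.nondegenerate h.symm h.φ_skew
  have h7 := congrArg (LinearMap.trace ℝ V) h1
  rw [map_add, LinearMap.trace_mul_comm ℝ (φ * A), ← mul_assoc, LinearMap.trace_mul_comm ℝ _ A,
    ← mul_assoc, h2, h3, map_neg, map_smul, h4] at h7
  simp only [smul_zero, neg_zero] at h7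
  linarith

/-- The divergence of `φ`, in the form `tr (u ↦ (∇_u φ) w) = 2n η(w)` where `2n + 1` is the
dimension. -/
theorem trace_flip_Dφ (h : ParacontactIdentities B ξ A φ DA Dφ) (w : V) :
    LinearMap.trace ℝ V (Dφ.flip w) = (Module.finrank ℝ V - 1) * B ξ w := by
  have h1 : LinearMap.trace ℝ V (Dφ.flip ξ) = Module.finrank ℝ V - 1 := by
    have : Dφ.flip ξ = -(φ * A) := LinearMap.ext fun u ↦ h.Dφ_apply_ξ u
    rw [this, map_neg, h.trace_φ_mul_A, neg_neg]
  have h2 : ∀ w, LinearMap.trace ℝ V (Dφ.flip (φ w)) = 0 := by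
    intro w
    have h3 : Dφ.flip (φ w) + φ * Dφ.flip w = -(B.flip w ∘ₗ A).smulRight ξ - B ξ w • A :=
      LinearMap.ext fun u ↦ h.Dφ_φ u w
    have h4 := congrArg (LinearMap.trace ℝ V) h3
    rw [map_add, map_sub, map_neg, map_smul, h.trace_A, LinearMap.trace_smulRight,
      LinearMap.comp_apply, h.A_ξ, map_zero] at h4
    -- closedness of the fundamental form: `Dφ.flip w - Dφ w` is the adjoint of `Dφ.flip w`
    have h5 := trace_eq_of_adjoint h.nondegenerate h.symm (T := φ * Dφ.flip w)
      (T' := -((Dφ.flip w - Dφ w) * φ)) fun u v ↦ by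
        change B (φ (Dφ u w)) v = B u (-(Dφ (φ v) w - Dφ w (φ v)))
        have := h.cyclic u (φ v) w
        rw [h.φ_skew, map_neg, map_sub]
        rw [← neg_eq_iff_eq_neg.2 (h.Dφ_skew (φ v) w u), h.symm.eq _ u] at this
        rw [h.symm.eq] at this
        linarith
    have h6 : LinearMap.trace ℝ V (Dφ w * φ) = 0 := by
      have := h.trace_mul_Dφ_mul_add 1 w
      rw [one_mul, map_add, LinearMap.trace_mul_comm ℝ φ, Module.End.one_apply,
        Module.End.one_apply, h.apply_A_ξ, h.ξ_A] at this
      linarith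
    rw [map_neg, sub_mul, map_sub, h6, LinearMap.trace_mul_comm ℝ _ φ] at h5
    simp only [smul_zero, neg_zero, sub_zero] at h4 h5
    linarith
  conv_lhs => rw [show w = φ (φ w) + B ξ w • ξ by rw [h.φ_sq, sub_add_cancel]]
  rw [map_add, map_add, h2, map_smul, map_smul, h1, smul_eq_mul]
  ring

/-- The squared norm of `∇ξ` is `-(2n + tr h²)`, where `h = ½ (φ ∇ξ - ∇ξ φ)`. -/
theorem sum_apply_A_A (h : ParacontactIdentities B ξ A φ DA Dφ) {ι : Type*} [Fintype ι]
    [DecidableEq ι] (b : Module.Basis ι ℝ V) {H : Module.End ℝ V}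
    (hH : ∀ v, H v = (1 / 2 : ℝ) • (φ (A v) - A (φ v))) :
    ∑ i, B (A (b i)) (A (B.dualBasis h.nondegenerate b i)) =
      -((Module.finrank ℝ V - 1) + LinearMap.trace ℝ V (H * H)) := by
  have h1 : ∀ u v, B (A u) (A v) = B ((A * A + (2 : ℝ) • (φ * A)) u) v := by
    intro u v
    rw [h.symm.eq, h.A_adjoint, h.symm.eq]
    rfl
  have h2 : ∀ v, H v = φ (A v) + φ (φ v) := by
    intro v
    rw [hH, eq_sub_of_add_eq (h.A_φ_add v)]
    module
  have h3 : H * H = φ * φ - A * A := by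
    ext v
    have h4 : φ (A (φ (A v))) = -A (A v) - (2 : ℝ) • φ (A v) := by
      have := congrArg φ (h.A_φ_add (A v))
      rw [map_add, h.φ_sq_A, map_neg, map_smul, h.φ_sq_A] at this
      rw [eq_sub_of_add_eq this]
      module
    change H (H v) = φ (φ v) - A (A v)
    rw [h2, h2, map_add, map_add, map_add, h4, h.A_φ_sq, h.φ_sq_A, map_add, h.φ_cube]
    module
  rw [Finset.sum_congr rfl fun i _ ↦ h1 _ _, sum_apply_dualBasis h.nondegenerate h.symm, h3,
    map_add, map_smul, map_sub, h.trace_φ_sq, h.trace_φ_mul_A, smul_eq_mul]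
  ring

/-- The trace of the second covariant derivative of `ξ` in terms of `tr (u ↦ (∇_u ∇ξ) w)`. -/
theorem sum_apply_DA (h : ParacontactIdentities B ξ A φ DA Dφ) {ι : Type*} [Fintype ι]
    [DecidableEq ι] (b : Module.Basis ι ℝ V) (w : V) :
    ∑ i, B (DA (b i) (B.dualBasis h.nondegenerate b i)) w =
      LinearMap.trace ℝ V (DA.flip w) + 2 * (Module.finrank ℝ V - 1) * B ξ w := by
  have h1 : ∀ u v, B (DA u v) w = B ((DA.flip w + (2 : ℝ) • Dφ.flip w) u) v := by
    intro u v
    have h2 := h.apply_Dφ u w v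
    rw [← neg_eq_iff_eq_neg.2 (h.Dφ_skew u w v)] at h2
    simp only [LinearMap.add_apply, LinearMap.smul_apply, LinearMap.flip_apply, map_add, map_smul,
      smul_eq_mul]
    linarith
  rw [Finset.sum_congr rfl fun i _ ↦ h1 _ _, sum_apply_dualBasis h.nondegenerate h.symm, map_add,
    map_smul, h.trace_flip_Dφ, smul_eq_mul]
  ring

end ParacontactIdentities

end PointwiseAlgebra

/-! ### Extensions of tangent vectors and covariant derivatives -/

theorem eventually_extend_add {x : M} (u v : TangentSpace 𝓘(ℝ, E) x) :
    ∀ᶠ y in 𝓝 x, extend E (u + v) y = extend E u y + extend E v y := by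
  let t := trivializationAt E (TangentSpace 𝓘(ℝ, E)) x
  have hx : x ∈ t.baseSet := mem_baseSet_trivializationAt' x
  filter_upwards [t.open_baseSet.mem_nhds hx] with y hy
  change t.symm y (t ⟨x, u + v⟩).2 = t.symm y (t ⟨x, u⟩).2 + t.symm y (t ⟨x, v⟩).2
  rw [(t.linear ℝ hx).map_add, ← t.coe_symmₗ (R := ℝ) hy, map_add]

theorem eventually_extend_smul {x : M} (c : ℝ) (v : TangentSpace 𝓘(ℝ, E) x) :
    ∀ᶠ y in 𝓝 x, extend E (c • v) y = c • extend E v y := by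
  let t := trivializationAt E (TangentSpace 𝓘(ℝ, E)) x
  have hx : x ∈ t.baseSet := mem_baseSet_trivializationAt' x
  filter_upwards [t.open_baseSet.mem_nhds hx] with y hy
  change t.symm y (t ⟨x, c • v⟩).2 = c • t.symm y (t ⟨x, v⟩).2
  rw [(t.linear ℝ hx).map_smul, ← t.coe_symmₗ (R := ℝ) hy, map_smul]

theorem mvfderiv_congr {f f' : M → ℝ} {x : M} (h : f =ᶠ[𝓝 x] f') : d% f x = d% f' x := by
  ext v
  simp only [mvfderiv, h.mfderiv_eq]
  rfl

namespace SemiRiemannianMetric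

variable (g : SemiRiemannianMetric E M)

theorem eq_of_val {x : M} {v w : TangentSpace 𝓘(ℝ, E) x} (h : ∀ u, g.val x v u = g.val x w u) :
    v = w := by
  rw [← sub_eq_zero]
  exact g.nondegenerate x _ fun u ↦ by rw [map_sub, sub_apply, h, sub_self]

theorem mvfderiv_val {Y Z : ∀ y : M, TangentSpace 𝓘(ℝ, E) y} {x : M}
    (hY : MDiffAt (T% Y) x) (hZ : MDiffAt (T% Z) x) (v : TangentSpace 𝓘(ℝ, E) x) :
    d% (fun y ↦ g.val y (Y y) (Z y)) x v =
      g.val x (g.leviCivita Y x v) (Z x) + g.val x (Y x) (g.leviCivita Z x v) := by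
  simpa using g.leviCivita_metric (mdifferentiableAt_extend 𝓘(ℝ, E) E v) hY hZ

theorem leviCivita_eq_add {Y Y' Z : ∀ y : M, TangentSpace 𝓘(ℝ, E) y} {x : M}
    (hZ : MDiffAt (T% Z) x) (hY : MDiffAt (T% Y) x) (hY' : MDiffAt (T% Y') x)
    (h : ∀ᶠ y in 𝓝 x, Z y = Y y + Y' y) :
    g.leviCivita Z x = g.leviCivita Y x + g.leviCivita Y' x :=
  (g.leviCivita_congr hZ (mdifferentiableAt_add_section hY hY') h).trans (g.leviCivita_add hY hY')

theorem leviCivita_eq_smul {c : ℝ} {Y Z : ∀ y : M, TangentSpace 𝓘(ℝ, E) y} {x : M}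
    (hZ : MDiffAt (T% Z) x) (hY : MDiffAt (T% Y) x) (h : ∀ᶠ y in 𝓝 x, Z y = c • Y y) :
    g.leviCivita Z x = c • g.leviCivita Y x :=
  (g.leviCivita_congr hZ (hY.smul_const_section (a := c)) h).trans (g.leviCivita_const_smul c hY)

/-! ### Symmetries of the curvature -/

/-- The first Bianchi identity, from the Jacobi identity and the vanishing of the torsion. -/
theorem curvature_bianchi {X Y Z : ∀ y : M, TangentSpace 𝓘(ℝ, E) y} {x : M}
    (hX : CMDiffAt ∞ (T% X) x) (hY : CMDiffAt ∞ (T% Y) x) (hZ : CMDiffAt ∞ (T% Z) x) :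
    g.curvature X Y Z x + g.curvature Y Z X x + g.curvature Z X Y x = 0 := by
  have key : ∀ {X Y Z : ∀ y : M, TangentSpace 𝓘(ℝ, E) y}, CMDiffAt ∞ (T% X) x →
      CMDiffAt ∞ (T% Y) x → CMDiffAt ∞ (T% Z) x →
      g.leviCivita Z x (mlieBracket 𝓘(ℝ, E) X Y x)
        - (g.leviCivita (fun y ↦ g.leviCivita Y y (X y)) x (Z x)
          - g.leviCivita (fun y ↦ g.leviCivita X y (Y y)) x (Z x)) =
        mlieBracket 𝓘(ℝ, E) (mlieBracket 𝓘(ℝ, E) X Y) Z x := by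
    intro X Y Z hX hY hZ
    have hXY := smooth_mlieBracket hX hY
    have h1 := mdiffAt_of_smooth (g.smooth_leviCivita hX hY)
    have h2 := mdiffAt_of_smooth (g.smooth_leviCivita hY hX)
    have h3 : ∀ᶠ y in 𝓝 x, g.leviCivita Y y (X y) - g.leviCivita X y (Y y) =
        mlieBracket 𝓘(ℝ, E) X Y y := by
      filter_upwards [eventually_mdiffAt_of_smooth hX, eventually_mdiffAt_of_smooth hY]
        with y hyX hyY
      exact g.leviCivita_torsion hyX hyY
    have h4 := g.leviCivita_eq_add h1 h2 (mdiffAt_of_smooth hXY) (h3.mono fun y hy ↦ by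
      rw [← hy]; abel)
    rw [h4, add_apply, add_sub_cancel_left,
      g.leviCivita_torsion (mdiffAt_of_smooth hXY) (mdiffAt_of_smooth hZ)]
  have h1 := key hX hY hZ
  have h2 := key hY hZ hX
  have h3 := key hZ hX hY
  have hJ := leibniz_mlieBracket hX hY hZ
  have h4 : mlieBracket 𝓘(ℝ, E) (mlieBracket 𝓘(ℝ, E) X Y) Z x
      + mlieBracket 𝓘(ℝ, E) (mlieBracket 𝓘(ℝ, E) Y Z) X x
      + mlieBracket 𝓘(ℝ, E) (mlieBracket 𝓘(ℝ, E) Z X) Y x = 0 := by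
    rw [mlieBracket_swap_apply (V := mlieBracket 𝓘(ℝ, E) Y Z), hJ,
      mlieBracket_swap_apply (V := mlieBracket 𝓘(ℝ, E) Z X), mlieBracket_swap (V := Z) (W := X)]
    have : mlieBracket 𝓘(ℝ, E) Y (-mlieBracket 𝓘(ℝ, E) X Z) x =
        -mlieBracket 𝓘(ℝ, E) Y (mlieBracket 𝓘(ℝ, E) X Z) x := by
      have := mlieBracket_const_smul_right (V := Y) (c := (-1 : ℝ))
        (mdiffAt_of_smooth (smooth_mlieBracket hX hZ))
      simpa using this
    rw [this]
    abel
  rw [← h1, ← h2, ← h3] at h4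
  rw [← h4]
  simp only [curvature]
  abel

/-- The curvature operators are skew-adjoint, as follows from applying the commutator `[X, Y]` to the
function `g(Z, W)`. -/
theorem curvature_skew {X Y Z W : ∀ y : M, TangentSpace 𝓘(ℝ, E) y} {x : M}
    (hX : CMDiffAt ∞ (T% X) x) (hY : CMDiffAt ∞ (T% Y) x) (hZ : CMDiffAt ∞ (T% Z) x)
    (hW : CMDiffAt ∞ (T% W) x) :
    g.val x (g.curvature X Y Z x) (W x) = -g.val x (Z x) (g.curvature X Y W x) := by
  have key : ∀ {U V : ∀ y : M, TangentSpace 𝓘(ℝ, E) y}, CMDiffAt ∞ (T% U) x →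
      CMDiffAt ∞ (T% V) x →
      d% (fun y ↦ d% (fun z ↦ g.val z (Z z) (W z)) y (V y)) x (U x) =
        g.val x (g.leviCivita (fun y ↦ g.leviCivita Z y (V y)) x (U x)) (W x)
        + g.val x (g.leviCivita Z x (V x)) (g.leviCivita W x (U x))
        + (g.val x (g.leviCivita Z x (U x)) (g.leviCivita W x (V x))
        + g.val x (Z x) (g.leviCivita (fun y ↦ g.leviCivita W y (V y)) x (U x))) := by
    intro U V hU hV
    have h1 := g.smooth_leviCivita hV hZ
    have h2 := g.smooth_leviCivita hV hW
    have hev : (fun y ↦ d% (fun z ↦ g.val z (Z z) (W z)) y (V y)) =ᶠ[𝓝 x]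
        fun y ↦ g.val y (g.leviCivita Z y (V y)) (W y)
          + g.val y (Z y) (g.leviCivita W y (V y)) := by
      filter_upwards [eventually_mdiffAt_of_smooth hZ, eventually_mdiffAt_of_smooth hW]
        with y hyZ hyW
      exact g.mvfderiv_val hyZ hyW _
    rw [mvfderiv_congr hev, mvfderiv_fun_add
      (g.mdiffAt_apply (mdiffAt_of_smooth h1) (mdiffAt_of_smooth hW))
      (g.mdiffAt_apply (mdiffAt_of_smooth hZ) (mdiffAt_of_smooth h2)), add_apply,
      g.mvfderiv_val (mdiffAt_of_smooth h1) (mdiffAt_of_smooth hW),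
      g.mvfderiv_val (mdiffAt_of_smooth hZ) (mdiffAt_of_smooth h2)]
  have h := mvfderiv_mlieBracket (g.smooth_val hZ hW) hX hY
  rw [key hX hY, key hY hX, g.mvfderiv_val (mdiffAt_of_smooth hZ) (mdiffAt_of_smooth hW)] at h
  simp only [curvature, map_sub, sub_apply]
  linarith

/-- Tensoriality of the curvature in its last argument, a consequence of its skewness. -/
theorem curvature_congr_right {X Y Z Z' : ∀ y : M, TangentSpace 𝓘(ℝ, E) y} {x : M}
    (hX : CMDiffAt ∞ (T% X) x) (hY : CMDiffAt ∞ (T% Y) x) (hZ : CMDiffAt ∞ (T% Z) x)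
    (hZ' : CMDiffAt ∞ (T% Z') x) (h : Z x = Z' x) :
    g.curvature X Y Z x = g.curvature X Y Z' x := by
  refine g.eq_of_val fun w ↦ ?_
  have h1 := g.curvature_skew hX hY hZ (smooth_extend w)
  have h2 := g.curvature_skew hX hY hZ' (smooth_extend w)
  rw [extend_apply_self] at h1 h2
  rw [h1, h2, h]

/-! ### Covariant derivatives of endomorphism fields -/

/-- Two fields of endomorphisms of the tangent spaces that are adjoint to each other with respect to
`g`, and that both map vector fields smooth at `x` to vector fields smooth at `x`. -/
structure AdjointPair (g : SemiRiemannianMetric E M)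
    (T T' : ∀ y : M, TangentSpace 𝓘(ℝ, E) y →L[ℝ] TangentSpace 𝓘(ℝ, E) y) (x : M) : Prop where
  adjoint : ∀ (y : M) (u v : TangentSpace 𝓘(ℝ, E) y), g.val y (T y u) v = g.val y u (T' y v)
  smooth_left : ∀ {X : ∀ y : M, TangentSpace 𝓘(ℝ, E) y}, CMDiffAt ∞ (T% X) x →
    CMDiffAt ∞ (T% (fun y ↦ T y (X y))) x
  smooth_right : ∀ {X : ∀ y : M, TangentSpace 𝓘(ℝ, E) y}, CMDiffAt ∞ (T% X) x →
    CMDiffAt ∞ (T% (fun y ↦ T' y (X y))) x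

/-- The covariant derivative `(∇_u T) v = ∇_u (T V) - T (∇_u V)` of a field of endomorphisms, where
`V` is an extension of `v`. -/
def nablaEnd (T : ∀ y : M, TangentSpace 𝓘(ℝ, E) y →L[ℝ] TangentSpace 𝓘(ℝ, E) y) (x : M)
    (hT : ∀ {X : ∀ y : M, TangentSpace 𝓘(ℝ, E) y}, CMDiffAt ∞ (T% X) x →
      CMDiffAt ∞ (T% (fun y ↦ T y (X y))) x) :
    TangentSpace 𝓘(ℝ, E) x →ₗ[ℝ] Module.End ℝ (TangentSpace 𝓘(ℝ, E) x) :=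
  LinearMap.mk₂ ℝ (fun u v ↦ g.leviCivita (fun y ↦ T y (extend E v y)) x u
      - T x (g.leviCivita (extend E v) x u))
    (by intro u u' v; simp only [map_add]; abel)
    (by intro c u v; simp only [map_smul, smul_sub])
    (by
      intro u v v'
      have h := eventually_extend_add v v'
      rw [g.leviCivita_eq_add (mdiffAt_of_smooth (smooth_extend (v + v')))
          (mdiffAt_of_smooth (smooth_extend v)) (mdiffAt_of_smooth (smooth_extend v')) h,
        g.leviCivita_eq_add (mdiffAt_of_smooth (hT (smooth_extend (v + v'))))
          (mdiffAt_of_smooth (hT (smooth_extend v))) (mdiffAt_of_smooth (hT (smooth_extend v')))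
          (h.mono fun y hy ↦ (congrArg (T y) hy).trans (map_add ..))]
      simp only [add_apply, map_add]
      abel)
    (by
      intro c u v
      have h := eventually_extend_smul c v
      rw [g.leviCivita_eq_smul (mdiffAt_of_smooth (smooth_extend (c • v)))
          (mdiffAt_of_smooth (smooth_extend v)) h,
        g.leviCivita_eq_smul (mdiffAt_of_smooth (hT (smooth_extend (c • v))))
          (mdiffAt_of_smooth (hT (smooth_extend v)))
          (h.mono fun y hy ↦ (congrArg (T y) hy).trans (map_smul ..))]
      simp only [smul_apply, map_smul, smul_sub])

/-- Tensoriality of `∇T`: the extension in its definition may be replaced by any smooth field. -/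
theorem nablaEnd_apply {T T' : ∀ y : M, TangentSpace 𝓘(ℝ, E) y →L[ℝ] TangentSpace 𝓘(ℝ, E) y}
    {x : M} (hT : g.AdjointPair T T' x) {X : ∀ y : M, TangentSpace 𝓘(ℝ, E) y}
    (hX : CMDiffAt ∞ (T% X) x) (u : TangentSpace 𝓘(ℝ, E) x) :
    g.nablaEnd T x hT.smooth_left u (X x) =
      g.leviCivita (fun y ↦ T y (X y)) x u - T x (g.leviCivita X x u) := by
  have key : ∀ {X : ∀ y : M, TangentSpace 𝓘(ℝ, E) y}, CMDiffAt ∞ (T% X) x → ∀ w,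
      g.val x (g.leviCivita (fun y ↦ T y (X y)) x u - T x (g.leviCivita X x u)) w =
        g.val x (X x) (g.leviCivita (fun y ↦ T' y (extend E w y)) x u)
          - g.val x (T x (X x)) (g.leviCivita (extend E w) x u) := by
    intro X hX w
    have hw : CMDiffAt ∞ (T% (extend E w)) x := smooth_extend w
    have h1 := g.mvfderiv_val (mdiffAt_of_smooth (hT.smooth_left hX)) (mdiffAt_of_smooth hw) u
    have h2 := g.mvfderiv_val (mdiffAt_of_smooth hX) (mdiffAt_of_smooth (hT.smooth_right hw)) u
    simp only [hT.adjoint, extend_apply_self] at h1 h2 ⊢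
    rw [h1] at h2
    rw [map_sub, sub_apply, hT.adjoint x (g.leviCivita X x u)]
    linarith
  refine g.eq_of_val fun w ↦ ?_
  rw [key hX]
  refine (key (smooth_extend (X x)) w).trans ?_
  rw [extend_apply_self]

/-! ### The second covariant derivative of a vector field -/

variable {V : ∀ y : M, TangentSpace 𝓘(ℝ, E) y}

/-- The Ricci identity for the endomorphism field `∇V`. -/
theorem nablaEnd_leviCivita_sub {x : M} (hV : CMDiffAt ∞ (T% V) x)
    (u v : TangentSpace 𝓘(ℝ, E) x) :
    g.nablaEnd (g.leviCivita V) x (fun hX ↦ g.smooth_leviCivita hX hV) u v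
      - g.nablaEnd (g.leviCivita V) x (fun hX ↦ g.smooth_leviCivita hX hV) v u =
      -g.curvature (extend E u) (extend E v) V x := by
  have h := g.leviCivita_torsion (mdiffAt_of_smooth (smooth_extend u))
    (mdiffAt_of_smooth (smooth_extend v))
  simp only [curvature, ← h, nablaEnd, LinearMap.mk₂_apply, extend_apply_self, map_sub]
  abel

/-- The first Bianchi identity in terms of `∇(∇V)`. -/
theorem nablaEnd_leviCivita_cyclic {x : M} (hV : CMDiffAt ∞ (T% V) x)
    (u v w : TangentSpace 𝓘(ℝ, E) x) :
    let D := g.nablaEnd (g.leviCivita V) x (fun hX ↦ g.smooth_leviCivita hX hV)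
    g.val x (D u v - D v u) w + g.val x (D v w - D w v) u + g.val x (D w u - D u w) v = 0 := by
  intro D
  have key : ∀ u v w, g.val x (D u v - D v u) w =
      g.val x (V x) (g.curvature (extend E u) (extend E v) (extend E w) x) := by
    intro u v w
    have h := g.curvature_skew (smooth_extend u) (smooth_extend v) hV (smooth_extend w)
    rw [extend_apply_self] at h
    rw [g.nablaEnd_leviCivita_sub hV, map_neg, neg_apply, h, neg_neg]
  rw [key, key, key, ← map_add, ← map_add, g.curvature_bianchi (smooth_extend u) (smooth_extend v)
    (smooth_extend w), map_zero]

/-- `ϱ(V, w) = tr (u ↦ (∇_u ∇V) w) - tr (∇_w ∇V)`, the contracted Ricci identity. -/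
theorem ricci_eq_trace {x : M} (hV : CMDiffAt ∞ (T% V) x) (w : TangentSpace 𝓘(ℝ, E) x) :
    let D := g.nablaEnd (g.leviCivita V) x (fun hX ↦ g.smooth_leviCivita hX hV)
    g.ricci x (V x) w = LinearMap.trace ℝ _ (D.flip w) - LinearMap.trace ℝ _ (D w) := by
  intro D
  let W := extend E w
  let Ξ := extend E (V x)
  have hW : CMDiffAt ∞ (T% W) x := smooth_extend w
  have hΞ : CMDiffAt ∞ (T% Ξ) x := smooth_extend (V x)
  have hskew : ∀ u v, g.val x (g.curvature W Ξ (extend E u) x) v =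
      -g.val x u (g.curvature W Ξ (extend E v) x) := by
    intro u v
    have := g.curvature_skew hW hΞ (smooth_extend u) (smooth_extend v)
    rwa [extend_apply_self, extend_apply_self] at this
  -- a map with an adjoint is linear
  let R : Module.End ℝ (TangentSpace 𝓘(ℝ, E) x) :=
    { toFun := fun u ↦ g.curvature W Ξ (extend E u) x
      map_add' := fun u v ↦ g.eq_of_val fun z ↦ by
        simp only [map_add, add_apply, hskew, neg_add]
      map_smul' := fun c u ↦ g.eq_of_val fun z ↦ by
        simp only [map_smul, smul_apply, hskew, smul_neg, RingHom.id_apply] }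
  have hR : LinearMap.trace ℝ _ R = 0 :=
    PointwiseAlgebra.trace_eq_zero_of_skew (g.bilin_nondegenerate x) (g.bilin_isSymm x) hskew
  have hB : ∀ z, g.curvatureAt x (V x) z w = (D.flip w - D w - R) z := by
    intro z
    have h1 := g.curvature_bianchi hΞ (smooth_extend z) hW
    have h2 := g.curvature_congr_right (smooth_extend z) hW hΞ hV (extend_apply_self ..)
    have h3 := g.nablaEnd_leviCivita_sub hV z w
    rw [h2, ← neg_eq_iff_eq_neg.2 h3] at h1
    change g.curvature Ξ (extend E z) W x = D z w - D w z - g.curvature W Ξ (extend E z) x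
    rw [← sub_eq_zero, ← h1]
    abel
  have hsum := PointwiseAlgebra.sum_apply_dualBasis (g.bilin_nondegenerate x) (g.bilin_isSymm x)
    (Module.finBasis ℝ (TangentSpace 𝓘(ℝ, E) x)) (D.flip w - D w - R)
  rw [map_sub, map_sub, hR, sub_zero] at hsum
  rw [← hsum]
  simp only [ricci, trace, hB]
  rfl

end SemiRiemannianMetric

/-! ### Paracontact metric structures -/

namespace ParacontactMetricStructure

open PointwiseAlgebra

variable {n : ℕ} (S : ParacontactMetricStructure n E M)

theorem smooth_φ {X : ∀ y : M, TangentSpace 𝓘(ℝ, E) y} {x : M} (hX : CMDiffAt ∞ (T% X) x) :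
    CMDiffAt ∞ (T% (fun y ↦ S.φ y (X y))) x :=
  ContMDiffAt.clm_bundle_apply (F₁ := E) (F₂ := E) (S.φ_smooth x) hX

theorem mdiffAt_ξ (x : M) : MDiffAt (T% S.ξ) x := mdiffAt_of_smooth (S.ξ_smooth x)

/-- The field of endomorphisms `∇ξ`. -/
def nablaξ (x : M) : TangentSpace 𝓘(ℝ, E) x →L[ℝ] TangentSpace 𝓘(ℝ, E) x :=
  S.g.leviCivita S.ξ x

theorem smooth_nablaξ {X : ∀ y : M, TangentSpace 𝓘(ℝ, E) y} {x : M}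
    (hX : CMDiffAt ∞ (T% X) x) : CMDiffAt ∞ (T% (fun y ↦ S.nablaξ y (X y))) x :=
  S.g.smooth_leviCivita hX (S.ξ_smooth x)

theorem val_ξ_ξ (x : M) : S.g.val x (S.ξ x) (S.ξ x) = 1 := by rw [← S.η_eq, S.η_ξ]

theorem val_nablaξ_ξ (x : M) (u : TangentSpace 𝓘(ℝ, E) x) :
    S.g.val x (S.nablaξ x u) (S.ξ x) = 0 := by
  have h1 := S.g.mvfderiv_val (S.mdiffAt_ξ x) (S.mdiffAt_ξ x) u
  simp only [S.val_ξ_ξ, mvfderiv_const] at h1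
  rw [S.g.symm x (S.ξ x)] at h1
  change 0 = S.g.val x (S.nablaξ x u) (S.ξ x) + S.g.val x (S.nablaξ x u) (S.ξ x) at h1
  linarith

/-- `-φ` is the skew-adjoint part of `∇ξ`: this is `dη(u, v) = g(u, φ v)` with `η = g(ξ, ·)`. -/
theorem val_φ (x : M) (u v : TangentSpace 𝓘(ℝ, E) x) : S.g.val x u (S.φ x v) =
    (1 / 2) * (S.g.val x (S.nablaξ x u) v - S.g.val x (S.nablaξ x v) u) := by
  have hu := mdifferentiableAt_extend 𝓘(ℝ, E) E u
  have hv := mdifferentiableAt_extend 𝓘(ℝ, E) E v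
  have h1 := S.g.mvfderiv_val (S.mdiffAt_ξ x) hu v
  have h2 := S.g.mvfderiv_val (S.mdiffAt_ξ x) hv u
  have h3 := S.g.leviCivita_torsion hu hv
  rw [← S.dη_eq, extDerivOneForm]
  simp only [S.η_eq, h1, h2, ← h3, map_sub, extend_apply_self, nablaξ]
  ring

theorem val_φ_left (x : M) (u v : TangentSpace 𝓘(ℝ, E) x) :
    S.g.val x (S.φ x u) v = S.g.val x u (-S.φ x v) := by
  rw [map_neg, S.g.symm, S.val_φ, S.val_φ]; ring

theorem φ_ξ (x : M) : S.φ x (S.ξ x) = 0 := by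
  refine S.g.eq_of_val fun u ↦ ?_
  rw [S.val_φ_left, map_neg, ← S.dη_eq, S.dη_ξ]
  simp

theorem adjointPair_φ (x : M) : S.g.AdjointPair S.φ (fun y ↦ -S.φ y) x where
  adjoint y u v := S.val_φ_left y u v
  smooth_left := S.smooth_φ
  smooth_right hX := (S.smooth_φ hX).neg_section

theorem adjointPair_nablaξ (x : M) :
    S.g.AdjointPair S.nablaξ (fun y ↦ S.nablaξ y + (S.φ y + S.φ y)) x where
  adjoint y u v := by
    simp only [add_apply, map_add]
    rw [S.val_φ, S.g.symm y u (S.nablaξ y v)]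
    ring
  smooth_left := S.smooth_nablaξ
  smooth_right hX := (S.smooth_nablaξ hX).add_section ((S.smooth_φ hX).add_section (S.smooth_φ hX))

/-- The covariant derivative of `φ`. -/
def nablaφ (x : M) : TangentSpace 𝓘(ℝ, E) x →ₗ[ℝ] Module.End ℝ (TangentSpace 𝓘(ℝ, E) x) :=
  S.g.nablaEnd S.φ x S.smooth_φ

/-- The covariant derivative of `∇ξ`. -/
def nablaNablaξ (x : M) : TangentSpace 𝓘(ℝ, E) x →ₗ[ℝ] Module.End ℝ (TangentSpace 𝓘(ℝ, E) x) :=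
  S.g.nablaEnd S.nablaξ x S.smooth_nablaξ

theorem leviCivita_φ {X : ∀ y : M, TangentSpace 𝓘(ℝ, E) y} {x : M} (hX : CMDiffAt ∞ (T% X) x)
    (u : TangentSpace 𝓘(ℝ, E) x) : S.g.leviCivita (fun y ↦ S.φ y (X y)) x u =
      S.nablaφ x u (X x) + S.φ x (S.g.leviCivita X x u) := by
  rw [nablaφ, S.g.nablaEnd_apply (S.adjointPair_φ x) hX, sub_add_cancel]

theorem leviCivita_nablaξ {X : ∀ y : M, TangentSpace 𝓘(ℝ, E) y} {x : M}
    (hX : CMDiffAt ∞ (T% X) x) (u : TangentSpace 𝓘(ℝ, E) x) :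
    S.g.leviCivita (fun y ↦ S.nablaξ y (X y)) x u =
      S.nablaNablaξ x u (X x) + S.nablaξ x (S.g.leviCivita X x u) := by
  rw [nablaNablaξ, S.g.nablaEnd_apply (S.adjointPair_nablaξ x) hX, sub_add_cancel]

theorem val_nablaφ (x : M) (w u v : TangentSpace 𝓘(ℝ, E) x) :
    S.g.val x u (S.nablaφ x w v) =
      (1 / 2) * (S.g.val x (S.nablaNablaξ x w u) v - S.g.val x (S.nablaNablaξ x w v) u) := by
  have hu := smooth_extend u
  have hv := smooth_extend v
  have hu' := mdiffAt_of_smooth hu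
  have hv' := mdiffAt_of_smooth hv
  have hAu := mdiffAt_of_smooth (S.smooth_nablaξ hu)
  have hAv := mdiffAt_of_smooth (S.smooth_nablaξ hv)
  have hφv := mdiffAt_of_smooth (S.smooth_φ hv)
  let f : M → ℝ := fun y ↦ S.g.val y (extend E u y) (S.φ y (extend E v y))
  let f' : M → ℝ := fun y ↦ S.g.val y (S.nablaξ y (extend E v y)) (extend E u y)
  have hf : MDiffAt f x := S.g.mdiffAt_apply hu' hφv
  have hf' : MDiffAt f' x := S.g.mdiffAt_apply hAv hu'
  have h1 : (fun y ↦ S.g.val y (S.nablaξ y (extend E u y)) (extend E v y)) = f' + (f + f) := by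
    ext y
    simp only [f, f', Pi.add_apply]
    rw [S.val_φ]
    ring
  have h2 := S.g.mvfderiv_val hAu hv' w
  rw [h1, mvfderiv_add hf' (hf.add hf), mvfderiv_add hf hf, add_apply, add_apply,
    S.g.mvfderiv_val hAv hu', S.g.mvfderiv_val hu' hφv] at h2
  simp only [S.leviCivita_φ hv, S.leviCivita_nablaξ hu, S.leviCivita_nablaξ hv,
    extend_apply_self, map_add, add_apply] at h2
  have h3 := S.val_φ x (S.g.leviCivita (extend E u) x w) v
  have h4 := S.val_φ x u (S.g.leviCivita (extend E v) x w)
  linarith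

theorem nablaφ_φ (x : M) (w v : TangentSpace 𝓘(ℝ, E) x) :
    S.nablaφ x w (S.φ x v) + S.φ x (S.nablaφ x w v) =
      -(S.g.val x (S.nablaξ x w) v • S.ξ x) - S.g.val x (S.ξ x) v • S.nablaξ x w := by
  have hv := smooth_extend v
  have hv' := mdiffAt_of_smooth hv
  have hf := S.g.mdiffAt_apply (S.mdiffAt_ξ x) hv'
  have h1 := S.g.leviCivita_eq_add hv' (mdiffAt_of_smooth (S.smooth_φ (S.smooth_φ hv)))
    (hf.smul_section (S.mdiffAt_ξ x)) (.of_forall fun y ↦ by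
      change _ = S.φ y (S.φ y (extend E v y)) + S.g.val y (S.ξ y) (extend E v y) • S.ξ y
      rw [S.φ_sq, S.η_eq, sub_add_cancel])
  have h2 := congrArg (fun T ↦ T w) h1
  have h3 := S.g.leviCivita_smul hf (S.mdiffAt_ξ x) w
  change _ = S.g.leviCivita (fun y ↦ S.φ y (S.φ y (extend E v y))) x w +
    S.g.leviCivita (fun y ↦ S.g.val y (S.ξ y) (extend E v y) • S.ξ y) x w at h2
  rw [h3, S.leviCivita_φ (S.smooth_φ hv), S.leviCivita_φ hv, map_add, S.φ_sq, S.η_eq,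
    S.g.mvfderiv_val (S.mdiffAt_ξ x) hv', extend_apply_self] at h2
  rw [← sub_eq_zero] at h2 ⊢
  rw [← neg_eq_zero, ← h2, nablaξ]
  module

theorem val_nablaNablaξ_ξ (x : M) (w u : TangentSpace 𝓘(ℝ, E) x) :
    S.g.val x (S.nablaNablaξ x w u) (S.ξ x) = -S.g.val x (S.nablaξ x u) (S.nablaξ x w) := by
  have hu := smooth_extend u
  have h1 := S.g.mvfderiv_val (mdiffAt_of_smooth (S.smooth_nablaξ hu)) (S.mdiffAt_ξ x) w
  simp only [S.val_nablaξ_ξ, mvfderiv_const, S.leviCivita_nablaξ hu, map_add, add_apply,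
    extend_apply_self] at h1
  change 0 = _ + 0 + S.g.val x (S.nablaξ x u) (S.nablaξ x w) at h1
  linarith

/-- At every point, `∇ξ`, `φ` and their covariant derivatives satisfy the algebraic identities. -/
theorem paracontactIdentities (x : M) :
    ParacontactIdentities (S.g.bilin x) (S.ξ x) (S.nablaξ x).toLinearMap (S.φ x).toLinearMap
      (S.nablaNablaξ x) (S.nablaφ x) where
  symm := S.g.bilin_isSymm x
  nondegenerate := S.g.bilin_nondegenerate x
  ξ_ξ := S.val_ξ_ξ x
  φ_sq v := (S.φ_sq x v).trans (by rw [S.η_eq]; rfl)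
  apply_φ := S.val_φ x
  apply_A_ξ := S.val_nablaξ_ξ x
  φ_ξ := S.φ_ξ x
  apply_Dφ := S.val_nablaφ x
  Dφ_φ := S.nablaφ_φ x
  cyclic u v w := by
    have h : _ = (0 : ℝ) := S.g.nablaEnd_leviCivita_cyclic (S.ξ_smooth x) u v w
    change S.g.val x (S.nablaNablaξ x u v - S.nablaNablaξ x v u) w
      + S.g.val x (S.nablaNablaξ x v w - S.nablaNablaξ x w v) u
      + S.g.val x (S.nablaNablaξ x w u - S.nablaNablaξ x u w) v = 0 at h
    change S.g.val x v (S.nablaφ x u w) + S.g.val x w (S.nablaφ x v u)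
      + S.g.val x u (S.nablaφ x w v) = 0
    simp only [map_sub, sub_apply] at h
    rw [S.val_nablaφ, S.val_nablaφ, S.val_nablaφ]
    linarith
  apply_DA_ξ := S.val_nablaNablaξ_ξ x

theorem nablaξ_φ_add (x : M) (v : TangentSpace 𝓘(ℝ, E) x) :
    S.nablaξ x (S.φ x v) + S.φ x (S.nablaξ x v) = (-2 : ℝ) • S.φ x (S.φ x v) :=
  ((S.paracontactIdentities x).A_φ_add v).trans (neg_smul _ _).symm

/-- The covariant derivative of the identity `∇ξ ∘ φ + φ ∘ ∇ξ = -2 φ²`. -/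
theorem nablaNablaξ_φ_add (x : M) (w v : TangentSpace 𝓘(ℝ, E) x) :
    S.nablaNablaξ x w (S.φ x v) + S.nablaξ x (S.nablaφ x w v)
      + (S.nablaφ x w (S.nablaξ x v) + S.φ x (S.nablaNablaξ x w v)) =
      -((2 : ℝ) • (S.nablaφ x w (S.φ x v) + S.φ x (S.nablaφ x w v))) := by
  have hv := smooth_extend v
  have h1 := mdiffAt_of_smooth (S.smooth_nablaξ (S.smooth_φ hv))
  have h2 := mdiffAt_of_smooth (S.smooth_φ (S.smooth_nablaξ hv))
  have h3 := mdiffAt_of_smooth (S.smooth_φ (S.smooth_φ hv))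
  have h4 := (S.g.leviCivita_add h1 h2).symm.trans (S.g.leviCivita_eq_smul (c := -2)
    (mdifferentiableAt_add_section h1 h2) h3 (.of_forall fun y ↦ S.nablaξ_φ_add y (extend E v y)))
  have h5 := congrArg (fun T ↦ T w) h4
  have h6 := S.nablaξ_φ_add x (S.g.leviCivita (extend E v) x w)
  simp only [add_apply, smul_apply, S.leviCivita_nablaξ (S.smooth_φ hv),
    S.leviCivita_φ (S.smooth_nablaξ hv), S.leviCivita_φ (S.smooth_φ hv), S.leviCivita_φ hv,
    S.leviCivita_nablaξ hv, extend_apply_self, map_add] at h5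
  rw [← sub_eq_zero] at h5 h6 ⊢
  refine Eq.trans ?_ ((congrArg₂ (fun a b ↦ a - b) h5 h6).trans (sub_zero 0))
  module

/-- `h = ½ (φ ∇ξ - ∇ξ φ)`, because `∇_ξ φ = 0`. -/
theorem h_apply (x : M) (v : TangentSpace 𝓘(ℝ, E) x) :
    S.h x v = (1 / 2 : ℝ) • (S.φ x (S.nablaξ x v) - S.nablaξ x (S.φ x v)) := by
  have hv := smooth_extend v
  rw [h, TensorialAt.mkHom_apply_eq_extend,
    ← S.g.leviCivita_torsion (S.mdiffAt_ξ x) (mdiffAt_of_smooth (S.smooth_φ hv)),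
    ← S.g.leviCivita_torsion (S.mdiffAt_ξ x) (mdiffAt_of_smooth hv), S.leviCivita_φ hv,
    extend_apply_self, (S.paracontactIdentities x).Dφ_ξ, map_sub, nablaξ]
  module

/-- `ϱ(ξ, w) = tr (u ↦ (∇_u ∇ξ) w)`, the other term of `ricci_eq_trace` being zero. -/
theorem ricci_ξ (x : M) (w : TangentSpace 𝓘(ℝ, E) x) :
    S.g.ricci x (S.ξ x) w = LinearMap.trace ℝ _ ((S.nablaNablaξ x).flip w) := by
  have h1 := S.g.ricci_eq_trace (S.ξ_smooth x) w
  have h2 := (S.paracontactIdentities x).trace_DA w (S.nablaNablaξ_φ_add x w)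
  exact h1.trans ((congrArg _ h2).trans (sub_zero _))

theorem finrank_tangentSpace (S : ParacontactMetricStructure n E M) (x : M) :
    (Module.finrank ℝ (TangentSpace 𝓘(ℝ, E) x) : ℝ) = 2 * n + 1 := by
  have : Module.finrank ℝ (TangentSpace 𝓘(ℝ, E) x) = 2 * n + 1 := S.finrank_eq
  rw [this]; push_cast; ring

theorem val_ricciOperator_ξ (x : M) (w : TangentSpace 𝓘(ℝ, E) x) :
    S.g.val x (S.g.ricciOperator x (S.ξ x)) w =
      LinearMap.trace ℝ _ ((S.nablaNablaξ x).flip w) := by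
  have h1 := apply_sum_smul_dualBasis (S.g.bilin_nondegenerate x) (S.g.bilin_isSymm x)
    (Module.finBasis ℝ (TangentSpace 𝓘(ℝ, E) x))
    (LinearMap.trace ℝ _ ∘ₗ (S.nablaNablaξ x).flip) w
  rw [LinearMap.comp_apply] at h1
  rw [← h1]
  simp only [SemiRiemannianMetric.ricciOperator, SemiRiemannianMetric.trace, S.ricci_ξ]
  rfl

theorem val_roughLaplacian (x : M) (w : TangentSpace 𝓘(ℝ, E) x) :
    S.g.val x (S.g.roughLaplacian S.ξ x) w =
      -∑ i, S.g.bilin x (S.nablaNablaξ x (Module.finBasis ℝ (TangentSpace 𝓘(ℝ, E) x) i)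
        ((S.g.bilin x).dualBasis (S.g.bilin_nondegenerate x)
          (Module.finBasis ℝ (TangentSpace 𝓘(ℝ, E) x)) i)) w := by
  rw [SemiRiemannianMetric.roughLaplacian, map_neg, neg_apply, ← LinearMap.sum_apply, ← map_sum]
  rfl

theorem roughLaplacian_ξ (x : M) : S.g.roughLaplacian S.ξ x =
    -(4 * (n : ℝ)) • S.ξ x - S.g.ricciOperator x (S.ξ x) := by
  refine S.g.eq_of_val fun w ↦ ?_
  rw [S.val_roughLaplacian, (S.paracontactIdentities x).sum_apply_DA, S.finrank_tangentSpace x,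
    map_sub, sub_apply, S.val_ricciOperator_ξ, map_smul, smul_apply, smul_eq_mul]
  change -(_ + 2 * (2 * (n : ℝ) + 1 - 1) * S.g.val x (S.ξ x) w) = _
  ring

theorem val_roughLaplacian_ξ (x : M) :
    S.g.val x (S.g.roughLaplacian S.ξ x) (S.ξ x) = S.g.normSqNabla S.ξ x := by
  rw [S.val_roughLaplacian, ← Finset.sum_neg_distrib]
  refine Finset.sum_congr rfl fun i _ ↦ ?_
  rw [(S.paracontactIdentities x).apply_DA_ξ, neg_neg, (S.g.bilin_isSymm x).eq]
  rfl

theorem normSqNabla_ξ (x : M) : S.g.normSqNabla S.ξ x = -(2 * (n : ℝ) + S.traceHSq x) := by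
  have h1 := (S.paracontactIdentities x).sum_apply_A_A
    (Module.finBasis ℝ (TangentSpace 𝓘(ℝ, E) x)) (H := (S.h x).toLinearMap) (S.h_apply x)
  rw [S.finrank_tangentSpace x, add_sub_cancel_right] at h1
  exact h1

end ParacontactMetricStructure

end Paracontact

end

theorem theorem3p2 {E : Type*} [NormedAddCommGroup E] [NormedSpace ℝ E] [FiniteDimensional ℝ E]
    {M : Type*} [TopologicalSpace M] [ChartedSpace E M] [IsManifold 𝓘(ℝ, E) ∞ M]
    (n : ℕ) (S : Paracontact.ParacontactMetricStructure n E M) (x : M) :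
    S.g.roughLaplacian S.ξ x = -(4 * (n : ℝ)) • S.ξ x - S.g.ricciOperator x (S.ξ x) ∧
    S.g.roughLaplacian S.ξ x =
      S.g.normSqNabla S.ξ x • S.ξ x - S.kerProj x (S.g.ricciOperator x (S.ξ x)) ∧
    S.g.normSqNabla S.ξ x = -(2 * (n : ℝ) + S.traceHSq x) := by
  refine ⟨S.roughLaplacian_ξ x, ?_, S.normSqNabla_ξ x⟩
  -- the `ξ`-component of `Δ̄ ξ` is `‖∇ξ‖²`, so that of `Q ξ` is `-4n - ‖∇ξ‖²`
  have h1 := S.val_roughLaplacian_ξ x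
  rw [S.roughLaplacian_ξ, S.g.symm, ← S.η_eq, map_sub, map_smul, S.η_ξ, smul_eq_mul,
    mul_one] at h1
  rw [S.roughLaplacian_ξ, ← h1, Paracontact.ParacontactMetricStructure.kerProj]
  module
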